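/- Let $G$ be a finite simple chordal graph (every cycle on at least $4$ vertices has a chord). A \emph{tree representation} of $G$ consists of a finite tree $T$ and, for each vertex $v$ of $G$, a nonempty subtree $S(v)$ of $T$, such that distinct vertices $u,v$ are adjacent in $G$ if and only if $S(u)$ and $S(v)$ have a common vertex. The \emph{leafage} $\ell(G)$ is the minimum, over all tree representations of $G$, of the number of leaves (vertices of degree $1$) of $T$. Let $\mathrm{lpt}(G)$ (respectively $\mathrm{lct}(G)$) be the minimum size of a set of vertices that intersects every longest path (respectively every longest cycle) of $G$. The graph $G$ is \emph{$2$-connected} if it has more than $2$ vertices and it remains connected after the deletion of any set of at most one vertex. There is an absolute constant $C$ such that every finite chordal graph $G$, with $m=\ell(G)$, satisfies the following. \begin{enumerate} \item If $G$ is connected, then $\mathrm{lpt}(G)\le C\,\bigl(\log_2 \max\{m,2\}\bigr)^2$. \item If $G$ is $2$-connected, then $\mathrm{lct}(G)\le C\,\log_2 \max\{m,2\}$. \end{enumerate} (The maximum matters only when $m<2$, i.e. when $G$ is complete and $m=0$.) -/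

import Mathlib

namespace SimpleGraph

variable {V : Type*}

/-- Every cycle on at least four vertices has a chord: an edge of the graph that joins two
vertices of the cycle and is not an edge of the cycle. -/
def IsChordalGraph (G : SimpleGraph V) : Prop :=
  ∀ (v : V) (c : G.Walk v v), c.IsCycle → 4 ≤ c.length →
    ∃ x ∈ c.support, ∃ y ∈ c.support, G.Adj x y ∧ s(x, y) ∉ c.edges

/-- `G` is `k`-connected: it has more than `k` vertices, and deleting fewer than `k` vertices
always leaves a connected graph. -/
def IsKConnected [Fintype V] (G : SimpleGraph V) (k : ℕ) : Prop :=
  k < Fintype.card V ∧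
    ∀ S : Finset V, S.card < k → (G.induce {v : V | v ∉ S}).Connected

/-- `p` is a path of `G` and no path of `G` is longer. -/
def IsLongestPath (G : SimpleGraph V) {u v : V} (p : G.Walk u v) : Prop :=
  p.IsPath ∧ ∀ (x y : V) (q : G.Walk x y), q.IsPath → q.length ≤ p.length

/-- `c` is a cycle of `G` and no cycle of `G` is longer. -/
def IsLongestCycle (G : SimpleGraph V) {v : V} (c : G.Walk v v) : Prop :=
  c.IsCycle ∧ ∀ (x : V) (d : G.Walk x x), d.IsCycle → d.length ≤ c.length

/-- A set of vertices that intersects every longest path. -/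
def IsLongestPathTransversal (G : SimpleGraph V) (A : Finset V) : Prop :=
  ∀ (u v : V) (p : G.Walk u v), G.IsLongestPath p → ∃ x ∈ A, x ∈ p.support

/-- A set of vertices that intersects every longest cycle. -/
def IsLongestCycleTransversal (G : SimpleGraph V) (A : Finset V) : Prop :=
  ∀ (v : V) (c : G.Walk v v), G.IsLongestCycle c → ∃ x ∈ A, x ∈ c.support

/-- The longest path transversal number of a finite graph: the minimum size of a longest path
transversal (the set of all vertices is one). -/
noncomputable def lpt (G : SimpleGraph V) : ℕ :=
  sInf {k : ℕ | ∃ A : Finset V, G.IsLongestPathTransversal A ∧ A.card = k}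

/-- The longest cycle transversal number of a finite graph: the minimum size of a longest cycle
transversal (the set of all vertices is one). -/
noncomputable def lct (G : SimpleGraph V) : ℕ :=
  sInf {k : ℕ | ∃ A : Finset V, G.IsLongestCycleTransversal A ∧ A.card = k}

/-- A tree representation of `G` with host tree `T`: each vertex `v` of `G` is assigned a subtree
of `T`, given by its vertex set, so that distinct vertices of `G` are adjacent exactly when their
subtrees intersect. Several vertices may be assigned the same subtree. -/
structure IsTreeRepresentation {W : Type*} (G : SimpleGraph V) (T : SimpleGraph W)
    (S : V → Set W) : Prop where
  isTree : T.IsTree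
  subtree_connected : ∀ v : V, (T.induce (S v)).Connected
  adj_iff : ∀ u v : V, u ≠ v → (G.Adj u v ↔ (S u ∩ S v).Nonempty)

/-- The number of leaves, that is, of vertices of degree one. -/
noncomputable def numLeaves {W : Type*} (T : SimpleGraph W) : ℕ :=
  {x : W | (T.neighborSet x).ncard = 1}.ncard

/-- The leafage of a chordal graph: the minimum number of leaves of the host tree of a (finite)
tree representation. Every finite tree is isomorphic to one on some `Fin n`. -/
noncomputable def leafage (G : SimpleGraph V) : ℕ :=
  sInf {k : ℕ | ∃ (n : ℕ) (T : SimpleGraph (Fin n)) (S : V → Set (Fin n)),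
    G.IsTreeRepresentation T S ∧ T.numLeaves = k}

end SimpleGraph

namespace List

variable {α : Type*}

/-- Splitting a list at the first entry with a given property. -/
theorem exists_eq_append_cons_of_exists {p : α → Prop} {l : List α} (h : ∃ a ∈ l, p a) :
    ∃ s a t, l = s ++ a :: t ∧ p a ∧ ∀ b ∈ s, ¬ p b := by
  induction l with
  | nil => simp at h
  | cons x l ih =>
    by_cases hx : p x
    · exact ⟨[], x, l, by simp, hx, by simp⟩
    · obtain ⟨s, a, t, rfl, ha, hs⟩ := ih (by
        obtain ⟨a, ha, hpa⟩ := h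
        rcases List.mem_cons.1 ha with rfl | ha
        · exact absurd hpa hx
        · exact ⟨a, ha, hpa⟩)
      refine ⟨x :: s, a, t, by simp, ha, ?_⟩
      intro b hb
      rcases List.mem_cons.1 hb with rfl | hb
      · exact hx
      · exact hs b hb

/-- Splitting a list at the last entry with a given property. -/
theorem exists_eq_append_cons_of_exists_last {p : α → Prop} {l : List α} (h : ∃ a ∈ l, p a) :
    ∃ s a t, l = s ++ a :: t ∧ p a ∧ ∀ b ∈ t, ¬ p b := by
  obtain ⟨s, a, t, hl, ha, hs⟩ :=
    exists_eq_append_cons_of_exists (p := p) (l := l.reverse) (by simpa using h)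
  refine ⟨t.reverse, a, s.reverse, ?_, ha, by simpa using hs⟩
  have := congrArg List.reverse hl
  simpa using this

theorem IsChain.forall_of_mem {R : α → α → Prop} {P : α → Prop} {l : List α} (hl : l.IsChain R)
    (hP : ∀ a ∈ l, ∀ b ∈ l, R a b → (P a ↔ P b)) {a : α} (ha : a ∈ l) (hPa : P a) :
    ∀ b ∈ l, P b := by
  induction l generalizing a with
  | nil => simp
  | cons x l ih =>
    cases l with
    | nil =>
      simp only [List.mem_singleton] at ha ⊢
      rintro b rfl; exact ha ▸ hPa
    | cons y l =>
      obtain ⟨hxy, hl⟩ := List.isChain_cons_cons.1 hl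
      have key : P x ↔ P y := hP x (by simp) y (by simp) hxy
      have ih' := fun a => ih hl (fun a ha b hb => hP a (List.mem_cons_of_mem _ ha) b
        (List.mem_cons_of_mem _ hb)) (a := a)
      rcases List.mem_cons.1 ha with rfl | ha
      · intro b hb
        rcases List.mem_cons.1 hb with rfl | hb
        · exact hPa
        · exact ih' y (by simp) (key.1 hPa) b hb
      · have hall := ih' a ha hPa
        intro b hb
        rcases List.mem_cons.1 hb with rfl | hb
        · exact key.2 (hall y (by simp))
        · exact hall b hb

end List

theorem Set.exists_forall_le_of_nat_bounded {α : Type*} {s : Set α} (f : α → ℕ) {N : ℕ}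
    (hN : ∀ a ∈ s, f a ≤ N) (hs : s.Nonempty) : ∃ a ∈ s, ∀ b ∈ s, f b ≤ f a := by
  have hfin : (f '' s).Finite := (Set.finite_Iic N).subset (by rintro _ ⟨a, ha, rfl⟩; exact hN a ha)
  obtain ⟨a, ha, hmax⟩ := Set.Finite.exists_maximalFor' f s hfin hs
  exact ⟨a, ha, fun b hb => (le_total (f b) (f a)).elim id (fun h => hmax hb h)⟩

namespace SimpleGraph

variable {V : Type*} {W : Type*} {G : SimpleGraph V}

/-- A representation of `G` by subtrees of a rooted tree, whose nodes carry the ancestor order: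
the set `S u` has the least element `r u`, and contains the ancestors of its elements from `r u`
on. -/
structure RootedRep (G : SimpleGraph V) [PartialOrder W] (S : V → Set W) (r : V → W) : Prop where
  comparable : ∀ {a b c : W}, a ≤ c → b ≤ c → a ≤ b ∨ b ≤ a
  top_mem : ∀ u, r u ∈ S u
  top_le : ∀ {u b}, b ∈ S u → r u ≤ b
  mem_of_le : ∀ {u a b}, b ∈ S u → r u ≤ a → a ≤ b → a ∈ S u
  adj_iff : ∀ {u w}, u ≠ w → (G.Adj u w ↔ (S u ∩ S w).Nonempty)

/-- The number of leaves of the rooted tree that are descendants of `h`. -/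
noncomputable def leavesAbove [PartialOrder W] (h : W) : ℕ := {b : W | IsMax b ∧ h ≤ b}.ncard

theorem one_le_leavesAbove [PartialOrder W] [Finite W] (h : W) : 1 ≤ leavesAbove h := by
  obtain ⟨b, hb, hm⟩ := Finite.exists_le_maximal (p := fun _ : W => True) (a := h) trivial
  refine (Set.ncard_pos (Set.toFinite _)).2 ⟨b, fun c hc => hm.2 trivial hc, hb⟩

namespace RootedRep

variable [PartialOrder W] {S : V → Set W} {r : V → W}

theorem adj_of_mem (R : RootedRep G S r) {u w : V} {a : W} (hu : a ∈ S u) (hw : a ∈ S w)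
    (h : u ≠ w) : G.Adj u w := (R.adj_iff h).2 ⟨a, hu, hw⟩

theorem top_mem_or_of_adj (R : RootedRep G S r) {u w : V} (h : G.Adj u w) :
    (r u ≤ r w ∧ r w ∈ S u) ∨ (r w ≤ r u ∧ r u ∈ S w) := by
  obtain ⟨a, hu, hw⟩ := (R.adj_iff h.ne).1 h
  rcases R.comparable (R.top_le hu) (R.top_le hw) with h | h
  · exact Or.inl ⟨h, R.mem_of_le hu h (R.top_le hw)⟩
  · exact Or.inr ⟨h, R.mem_of_le hw h (R.top_le hu)⟩

theorem mem_of_adj (R : RootedRep G S r) {u w : V} {h : W} (ha : G.Adj u w) (hu : h ≤ r u)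
    (hw : ¬ h ≤ r w) : h ∈ S w := by
  rcases R.top_mem_or_of_adj ha with ⟨h1, _⟩ | ⟨h1, h2⟩
  · exact absurd (hu.trans h1) hw
  · rcases R.comparable hu h1 with h3 | h3
    · exact absurd h3 hw
    · exact R.mem_of_le h2 h3 hu

theorem le_top_of_isChain (R : RootedRep G S r) {l : List V} {h : W} (hl : l.IsChain G.Adj)
    (hS : ∀ u ∈ l, h ∉ S u) {u : V} (hu : u ∈ l) (hle : h ≤ r u) : ∀ w ∈ l, h ≤ r w := by
  refine hl.forall_of_mem (P := fun w => h ≤ r w) ?_ hu hle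
  intro a ha b hb hab
  constructor
  · intro h1; by_contra h2; exact hS b hb (R.mem_of_adj hab h1 h2)
  · intro h1; by_contra h2; exact hS a ha (R.mem_of_adj hab.symm h1 h2)

theorem leavesAbove_add_le (R : RootedRep G S r) [Finite W] {h g g' : W} (hg : h ≤ g)
    (hg' : h ≤ g') (h1 : ¬ g ≤ g') (h2 : ¬ g' ≤ g) :
    leavesAbove g + leavesAbove g' ≤ leavesAbove h := by
  unfold leavesAbove
  rw [← Set.ncard_union_eq]
  · apply Set.ncard_le_ncard _ (Set.toFinite _)
    rintro b (⟨hb, hb'⟩ | ⟨hb, hb'⟩)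
    · exact ⟨hb, hg.trans hb'⟩
    · exact ⟨hb, hg'.trans hb'⟩
  · rw [Set.disjoint_left]
    rintro b ⟨_, hb⟩ ⟨_, hb'⟩
    exact (R.comparable hb hb').elim h1 h2

end RootedRep

/-- A family of vertex sequences in `G` with a notion of contiguous piece, in which no piece can be
lengthened by exchanging its interior for new vertices. -/
structure ExchangeFamily {ι : Type*} (G : SimpleGraph V) (supp : ι → Set V)
    (seg : ι → List V → Prop) : Prop where
  infix_closed : ∀ {c l l'}, seg c l → l' <:+: l → seg c l'
  isChain : ∀ {c l}, seg c l → l.IsChain G.Adj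
  nodup : ∀ {c l}, seg c l → l.Nodup
  mem : ∀ {c l}, seg c l → ∀ x ∈ l, x ∈ supp c
  exchange : ∀ {c z Q y X}, seg c (z :: (Q ++ [y])) → (z :: (X ++ [y])).IsChain G.Adj → X.Nodup →
    (∀ x ∈ X, x ∉ supp c) → X.length ≤ Q.length

/-- The sequence `c` makes an excursion from `B` to `B` through vertices below `h`. -/
def InnerExcursion {ι : Type*} [LE W] (r : V → W) (seg : ι → List V → Prop) (c : ι) (h : W)
    (B : Set V) : Prop :=
  ∃ z l z', seg c (z :: (l ++ [z'])) ∧ z ∈ B ∧ z' ∈ B ∧ ∀ w ∈ l, h ≤ r w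

end SimpleGraph

namespace SimpleGraph

variable {V : Type*} {W : Type*} {G : SimpleGraph V}

section Recursion

variable [PartialOrder W] {S : V → Set W} {r : V → W} {ι : Type*} {supp : ι → Set V}
  {seg : ι → List V → Prop}

theorem ExchangeFamily.exists_first_neighbor (R : RootedRep G S r)
    (E : ExchangeFamily G supp seg) {h : W} {B : Set V} (hB : ∀ x ∈ B, h ∈ S x) {v : V}
    (hv : v ∈ B) {c : ι} (hc : InnerExcursion r seg c h B) (hvc : v ∉ supp c) :
    ∃ z Q y, seg c (z :: (Q ++ [y])) ∧ z ∈ B ∧ G.Adj v y ∧ ∀ q ∈ Q, ¬ G.Adj v q ∧ h ≤ r q := by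
  obtain ⟨z, l, z', hseg, hz, hz', hl⟩ := hc
  have hvz' : G.Adj v z' := R.adj_of_mem (hB v hv) (hB z' hz') (by
    rintro rfl; exact hvc (E.mem hseg _ (by simp)))
  obtain ⟨Q, y, t, hQ, hy, hQn⟩ := List.exists_eq_append_cons_of_exists
    (p := fun y => G.Adj v y) (l := l ++ [z']) ⟨z', by simp, hvz'⟩
  refine ⟨z, Q, y, E.infix_closed hseg ⟨[], t, by simp [hQ]⟩, hz, hy, fun q hq => ⟨hQn q hq, ?_⟩⟩
  have : q ∈ l ++ [z'] := by simp [hQ, hq]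
  rcases List.mem_append.1 this with h1 | h1
  · exact hl q h1
  · rw [List.mem_singleton.1 h1] at hq
    exact absurd hvz' (hQn z' hq)

theorem ExchangeFamily.exists_halving [Finite V] [Finite W] (R : RootedRep G S r)
    (E : ExchangeFamily G supp seg) {h : W} {B : Set V} (hB : ∀ x ∈ B, h ∈ S x) {F : Set ι}
    (hF : ∀ c ∈ F, InnerExcursion r seg c h B) :
    ∃ A : Finset V, A.card ≤ 3 ∧ ((∀ c ∈ F, ∃ x ∈ A, x ∈ supp c) ∨
      ∃ h', 2 * leavesAbove h' ≤ leavesAbove h ∧ h < h' ∧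
        ∀ c ∈ F, (∀ x ∈ A, x ∉ supp c) → ∃ u ∈ supp c, h' ≤ r u) := by
  classical
  have := Fintype.ofFinite V
  rcases F.eq_empty_or_nonempty with rfl | ⟨c₀, hc₀⟩
  · exact ⟨∅, by simp, Or.inl (by simp)⟩
  have hBne : B.Nonempty := by
    obtain ⟨z, l, z', hseg, hz, _⟩ := hF c₀ hc₀
    exact ⟨z, hz⟩
  set heavy : Set W := {g | h ≤ g ∧ leavesAbove h < 2 * leavesAbove g} with hheavy
  obtain ⟨v, hv, hvmax⟩ := Set.exists_max_image B (fun v => (S v ∩ heavy).ncard)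
    (Set.toFinite _) hBne
  by_cases hall : ∀ c ∈ F, v ∈ supp c
  · exact ⟨{v}, by simp, Or.inl fun c hc => ⟨v, by simp, hall c hc⟩⟩
  push Not at hall
  obtain ⟨c₁, hc₁, hvc₁⟩ := hall
  set 𝒯 : Set (ι × V × List V × V) := {p | p.1 ∈ F ∧ v ∉ supp p.1 ∧
    seg p.1 (p.2.1 :: (p.2.2.1 ++ [p.2.2.2])) ∧ p.2.1 ∈ B ∧ G.Adj v p.2.2.2 ∧
    ∀ q ∈ p.2.2.1, ¬ G.Adj v q ∧ h ≤ r q} with h𝒯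
  have hentry : ∀ c ∈ F, v ∉ supp c → ∃ z Q y, (c, z, Q, y) ∈ 𝒯 := by
    intro c hc hvc
    obtain ⟨z, Q, y, h1⟩ := E.exists_first_neighbor R hB hv (hF c hc) hvc
    exact ⟨z, Q, y, hc, hvc, h1⟩
  have hbound : ∀ p ∈ 𝒯, (fun p : ι × V × List V × V => p.2.2.1.length) p ≤ Fintype.card V := by
    rintro ⟨c, z, Q, y⟩ ⟨_, _, hseg, _⟩
    refine List.Nodup.length_le_card ?_
    exact (E.nodup hseg).sublist ((List.sublist_append_left _ _).trans (List.sublist_cons_self _ _))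
  obtain ⟨⟨c₂, x₁, Q₁, x₂⟩, ⟨hc₂, hvc₂, hseg, hx₁, hx₂, hQ₁⟩, hmax⟩ :=
    Set.exists_forall_le_of_nat_bounded _ hbound (by
      obtain ⟨z, Q, y, h1⟩ := hentry c₁ hc₁ hvc₁
      exact ⟨_, h1⟩)
  simp only at hc₂ hvc₂ hseg hx₁ hx₂ hQ₁ hmax
  have hmemc₂ := E.mem hseg
  have hvx₁ : G.Adj x₁ v := R.adj_of_mem (hB _ hx₁) (hB _ hv) (by
    rintro rfl; exact hvc₂ (hmemc₂ _ (by simp)))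
  obtain ⟨p, Q', rfl⟩ : ∃ p Q', Q₁ = p :: Q' := by
    cases Q₁ with
    | cons p Q' => exact ⟨p, Q', rfl⟩
    | nil =>
      have := E.exchange (X := [v]) hseg (by simp [hvx₁, hx₂]) (by simp) (by simpa using hvc₂)
      simp at this
  have hchain := E.isChain hseg
  have hx₁p : G.Adj x₁ p := by
    have : [x₁, p].IsChain G.Adj := hchain.infix ⟨[], Q' ++ [x₂], by simp⟩
    simpa using this
  have hnotmem : ∀ q ∈ p :: Q', r q ∉ S v := by
    intro q hq hrq
    refine (hQ₁ q hq).1 (R.adj_of_mem hrq (R.top_mem q) ?_)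
    rintro rfl
    exact hvc₂ (hmemc₂ _ (by simp at hq ⊢; tauto))
  obtain ⟨h', hmin⟩ := Set.Finite.exists_minimal
    (s := {a : W | h ≤ a ∧ a ≤ r p ∧ a ∉ S v}) (Set.toFinite _)
    ⟨r p, (hQ₁ p (by simp)).2, le_rfl, hnotmem p (by simp)⟩
  obtain ⟨⟨hh', hh'p, hh'v⟩, hmin⟩ := hmin
  have hlt : h < h' := lt_of_le_of_ne hh' (by rintro rfl; exact hh'v (hB v hv))
  have hQh' : ∀ q ∈ p :: Q', h' ≤ r q := by
    have hch : (p :: Q').IsChain G.Adj := hchain.infix ⟨[x₁], [x₂], by simp⟩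
    have key : ∀ a ∈ p :: Q', ∀ b ∈ p :: Q', G.Adj a b → h' ≤ r a → h' ≤ r b := by
      intro a ha b hb hab h1
      by_contra h2
      have h3 := R.mem_of_adj hab h1 h2
      have h4 := R.top_le h3
      refine hnotmem b hb ?_
      by_contra h5
      exact h2 (hmin ⟨(hQ₁ b hb).2, h4.trans hh'p, h5⟩ h4)
    exact hch.forall_of_mem (fun a ha b hb hab => ⟨key a ha b hb hab, key b hb a ha hab.symm⟩)
      (List.mem_cons_self) hh'p
  have hx₁h' : h' ∈ S x₁ := by
    refine R.mem_of_adj hx₁p.symm hh'p fun h1 => ?_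
    exact absurd (h1.trans (R.top_le (hB _ hx₁))) hlt.not_ge
  have hlam : 2 * leavesAbove h' ≤ leavesAbove h := by
    by_contra hcon
    push Not at hcon
    have hss : S v ∩ heavy ⊂ S x₁ ∩ heavy := by
      rw [Set.ssubset_iff_of_subset]
      · exact ⟨h', ⟨hx₁h', hh', hcon⟩, fun h1 => hh'v h1.1⟩
      · rintro g ⟨hgv, hg, hgl⟩
        refine ⟨?_, hg, hgl⟩
        have hcomp : g ≤ h' := by
          by_contra h1
          by_cases h2 : h' ≤ g
          · exact hh'v (R.mem_of_le hgv ((R.top_le (hB v hv)).trans hh') h2)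
          · have := R.leavesAbove_add_le hg hh' h1 h2
            omega
        exact R.mem_of_le hx₁h' ((R.top_le (hB _ hx₁)).trans hg) hcomp
    exact absurd (Set.ncard_lt_ncard hss (Set.toFinite _)) (hvmax x₁ hx₁).not_gt
  refine ⟨{v, x₁, x₂}, Finset.card_le_three, Or.inr ⟨h', hlam, hlt, ?_⟩⟩
  intro c hc hA
  simp only [Finset.mem_insert, Finset.mem_singleton, forall_eq_or_imp, forall_eq] at hA
  obtain ⟨hvc, hx₁c, hx₂c⟩ := hA
  by_contra hcon
  push Not at hcon
  obtain ⟨z, Q, y, hT⟩ := hentry c hc hvc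
  have hlen := hmax _ hT
  obtain ⟨_, _, hseg', hz, hy, hQ⟩ := hT
  simp only at hlen hseg' hz hy hQ
  have hmemc := E.mem hseg'
  have hzx₁ : G.Adj z x₁ := R.adj_of_mem (hB _ hz) (hB _ hx₁) (by
    rintro rfl; exact hx₁c (hmemc _ (by simp)))
  have := E.exchange (X := x₁ :: ((p :: Q') ++ [x₂, v])) hseg' (by
      have e : z :: (x₁ :: ((p :: Q') ++ [x₂, v]) ++ [y]) =
        ([z] ++ (x₁ :: (p :: Q'))) ++ x₂ :: v :: [y] := by simp
      rw [e, List.isChain_append_cons_cons]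
      refine ⟨?_, hx₂.symm, by simpa using hy⟩
      have : (z :: x₁ :: ((p :: Q') ++ [x₂])).IsChain G.Adj :=
        List.isChain_cons_cons.2 ⟨hzx₁, hchain⟩
      simpa using this) (by
      have e : x₁ :: ((p :: Q') ++ [x₂, v]) = (x₁ :: ((p :: Q') ++ [x₂])) ++ [v] := by simp
      rw [e, List.nodup_append']
      refine ⟨E.nodup hseg, by simp, ?_⟩
      intro w hw hw'
      rw [List.mem_singleton.1 hw'] at hw
      exact hvc₂ (hmemc₂ _ hw)) (by
      intro x hx
      simp only [List.mem_cons, List.mem_append, List.not_mem_nil, or_false, or_assoc] at hx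
      rcases hx with rfl | rfl | hx | rfl | rfl
      · exact hx₁c
      · exact fun h1 => hcon _ h1 hh'p
      · exact fun h1 => hcon _ h1 (hQh' x (by simp [hx]))
      · exact hx₂c
      · exact hvc)
  simp at this hlen
  omega

/-- Recursion along the halving step. -/
theorem ExchangeFamily.exists_transversal [Finite V] [Finite W] (R : RootedRep G S r)
    (E : ExchangeFamily G supp seg)
    (htrans : ∀ h : W, ∃ H : Finset V, H.card ≤ 3 ∧ ∀ c, (∀ x ∈ H, x ∉ supp c) →
      (∃ u ∈ supp c, h ≤ r u) → (∃ x ∈ supp c, ∃ y ∈ supp c, x ≠ y ∧ ¬ h ≤ r x ∧ ¬ h ≤ r y) →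
      InnerExcursion r seg c h {u | h ∈ S u ∧ ¬ h ≤ r u})
    (n : ℕ) : ∀ (h : W) (B : Set V) (F : Set ι), leavesAbove h ≤ n → (∀ x ∈ B, h ∈ S x) →
      (∀ c ∈ F, InnerExcursion r seg c h B) →
      ∃ A : Finset V, A.card ≤ 6 * (Nat.log 2 (leavesAbove h) + 1) ∧
        ∀ c ∈ F, ∃ x ∈ A, x ∈ supp c := by
  classical
  induction n using Nat.strong_induction_on with
  | _ n ih =>
  intro h B F hn hB hF
  obtain ⟨A, hA, hA' | ⟨h', hlam, hlt, hA'⟩⟩ := E.exists_halving R hB hF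
  · exact ⟨A, by omega, hA'⟩
  obtain ⟨H, hH, hH'⟩ := htrans h'
  have h1 := one_le_leavesAbove h'
  obtain ⟨A₂, hA₂, hA₂'⟩ := ih (leavesAbove h') (by omega) h' {u | h' ∈ S u ∧ ¬ h' ≤ r u}
    {c ∈ F | (∀ x ∈ A, x ∉ supp c) ∧ ∀ x ∈ H, x ∉ supp c} le_rfl (fun x hx => hx.1) (by
      rintro c ⟨hcF, hcA, hcH⟩
      refine hH' c hcH (hA' c hcF hcA) ?_
      obtain ⟨z, l, z', hseg, hz, hz', _⟩ := hF c hcF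
      have hnot : ∀ x ∈ B, ¬ h' ≤ r x := fun x hx h2 =>
        absurd (h2.trans (R.top_le (hB x hx))) hlt.not_ge
      refine ⟨z, E.mem hseg _ (by simp), z', E.mem hseg _ (by simp), ?_, hnot z hz, hnot z' hz'⟩
      rintro rfl
      exact (List.nodup_cons.1 (E.nodup hseg)).1 (by simp))
  refine ⟨A ∪ H ∪ A₂, ?_, ?_⟩
  · have h2 : Nat.log 2 (leavesAbove h') + 1 ≤ Nat.log 2 (leavesAbove h) := by
      rw [← Nat.log_mul_base (by norm_num) (by omega)]
      exact Nat.log_mono_right (by omega)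
    have h3 := Finset.card_union_le (A ∪ H) A₂
    have h4 := Finset.card_union_le A H
    omega
  · intro c hc
    by_cases h2 : ∃ x ∈ A ∪ H, x ∈ supp c
    · obtain ⟨x, hx, hxc⟩ := h2
      exact ⟨x, Finset.mem_union_left _ hx, hxc⟩
    · push Not at h2
      obtain ⟨x, hx, hxc⟩ := hA₂' c ⟨hc, fun x hx => h2 x (Finset.mem_union_left _ hx),
        fun x hx => h2 x (Finset.mem_union_right _ hx)⟩
      exact ⟨x, Finset.mem_union_right _ hx, hxc⟩

end Recursion

end SimpleGraph

namespace List

variable {α : Type*} {R : α → α → Prop}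

theorem isChain_append_interior {s X t : List α} {z y : α} :
    (s ++ z :: (X ++ y :: t)).IsChain R ↔
      (s ++ [z]).IsChain R ∧ (z :: (X ++ [y])).IsChain R ∧ (y :: t).IsChain R := by
  rw [List.isChain_split, ← List.cons_append,
    List.isChain_split (c := y) (l₁ := z :: X), List.cons_append]

theorem Nodup.exchange_interior {s Q X t : List α} {z y : α}
    (h : (s ++ z :: (Q ++ y :: t)).Nodup) (hX : X.Nodup)
    (hd : ∀ x ∈ X, x ∉ s ++ z :: (Q ++ y :: t)) : (s ++ z :: (X ++ y :: t)).Nodup := by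
  simp only [List.nodup_append', List.nodup_cons, List.mem_append, List.mem_cons, not_or,
    List.disjoint_cons_right, List.disjoint_append_right] at h hd ⊢
  have hs : ∀ a ∈ X, a ∉ s := fun a ha => (hd a ha).1
  have ht : ∀ a ∈ X, a ∉ t := fun a ha => (hd a ha).2.2.2.2
  have hz : z ∉ X := fun hz => (hd z hz).2.1 rfl
  have hy : y ∉ X := fun hy => (hd y hy).2.2.2.1 rfl
  refine ⟨h.1, ⟨⟨hz, h.2.1.1.2⟩, hX, h.2.1.2.2.1, hy, fun a ha => ht a ha⟩, h.2.2.1,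
    fun a ha hb => hs a hb ha, h.2.2.2.2⟩

/-- An entry with `p` between two entries without `p` lies in a run of entries with `p`, flanked by
entries without `p`. -/
theorem exists_run_infix {p : α → Prop} {l s t : List α} {u : α} (hl : l = s ++ u :: t)
    (hu : p u) (hs : ∃ x ∈ s, ¬ p x) (ht : ∃ x ∈ t, ¬ p x) :
    ∃ z w W z', z :: (w :: W ++ [z']) <:+: l ∧ ¬ p z ∧ ¬ p z' ∧ ∀ x ∈ w :: W, p x := by
  obtain ⟨s₁, z, s₂, rfl, hz, hs₂⟩ := List.exists_eq_append_cons_of_exists_last hs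
  obtain ⟨t₁, z', t₂, rfl, hz', ht₁⟩ := List.exists_eq_append_cons_of_exists ht
  push Not at hs₂ ht₁
  have hall : ∀ x ∈ s₂ ++ u :: t₁, p x := by
    intro x hx
    rcases List.mem_append.1 hx with h | h
    · exact hs₂ x h
    · rcases List.mem_cons.1 h with rfl | h
      · exact hu
      · exact ht₁ x h
  have hinf : z :: ((s₂ ++ u :: t₁) ++ [z']) <:+: l := ⟨s₁, t₂, by simp [hl]⟩
  obtain ⟨w, W, hW⟩ : ∃ w W, s₂ ++ u :: t₁ = w :: W := by
    cases s₂ <;> simp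
  rw [hW] at hinf hall
  exact ⟨z, w, W, z', hinf, hz, hz', hall⟩

end List

namespace SimpleGraph

variable {V : Type*} {W : Type*} {G : SimpleGraph V}

/-- The vertex sequences of the longest paths. -/
def LongestPathList (G : SimpleGraph V) (l : List V) : Prop :=
  (l.IsChain G.Adj ∧ l.Nodup) ∧ ∀ l' : List V, l'.IsChain G.Adj → l'.Nodup → l'.length ≤ l.length

/-- The cyclic vertex sequences of the cycles. -/
def IsVertexCycle (G : SimpleGraph V) (c : Cycle V) : Prop :=
  c.Chain G.Adj ∧ c.Nodup ∧ 3 ≤ c.length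

/-- The cyclic vertex sequences of the longest cycles. -/
def LongestVertexCycle (G : SimpleGraph V) (c : Cycle V) : Prop :=
  G.IsVertexCycle c ∧ ∀ c' : Cycle V, G.IsVertexCycle c' → c'.length ≤ c.length

theorem LongestPathList.reverse {l : List V} (h : G.LongestPathList l) :
    G.LongestPathList l.reverse := by
  refine ⟨⟨?_, by simpa using h.1.2⟩, by simpa using h.2⟩
  rw [List.isChain_reverse]
  exact h.1.1.imp fun a b hab => hab.symm

theorem exchangeFamily_longestPathList (G : SimpleGraph V) :
    ExchangeFamily G (fun c : {l // G.LongestPathList l} => {x | x ∈ c.1})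
      (fun c l => l <:+: c.1) where
  infix_closed h h' := h'.trans h
  isChain {c _} h := c.2.1.1.infix h
  nodup {c _} h := c.2.1.2.sublist h.sublist
  mem h x hx := h.subset hx
  exchange := by
    rintro ⟨c, hc⟩ z Q y X ⟨s, t, hst⟩ hch hX hd
    simp only at hst
    have e : c = s ++ z :: (Q ++ y :: t) := by rw [← hst]; simp
    subst e
    have h1 := hc.1.1
    rw [List.isChain_append_interior] at h1
    have := hc.2 (s ++ z :: (X ++ y :: t)) (List.isChain_append_interior.2 ⟨h1.1, hch, h1.2.2⟩)
      (hc.1.2.exchange_interior hX hd)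
    simp at this
    omega

theorem exchangeFamily_longestVertexCycle (G : SimpleGraph V) :
    ExchangeFamily G (fun c : {c // G.LongestVertexCycle c} => {x | x ∈ c.1})
      (fun c l => ∃ m : List V, c.1 = ↑(l ++ m)) where
  infix_closed := by
    rintro c l l' ⟨m, hm⟩ ⟨s, t, rfl⟩
    refine ⟨t ++ m ++ s, ?_⟩
    rw [hm, Cycle.coe_eq_coe]
    have := List.isRotated_append (l := s) (l' := l' ++ (t ++ m))
    simpa using this
  isChain := by
    rintro ⟨c, hc⟩ l ⟨m, hm⟩
    have h := hc.1.1
    simp only at hm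
    rw [hm] at h
    cases l with
    | nil => simp
    | cons a l =>
      rw [List.cons_append, Cycle.chain_coe_cons] at h
      exact h.infix ⟨[], m ++ [a], by simp⟩
  nodup := by
    rintro ⟨c, hc⟩ l ⟨m, hm⟩
    have h := hc.1.2.1
    simp only at hm
    rw [hm, Cycle.nodup_coe_iff] at h
    exact h.sublist (List.sublist_append_left _ _)
  mem := by
    rintro ⟨c, hc⟩ l ⟨m, hm⟩ x hx
    simp only at hm
    simp only [hm, Set.mem_ofPred_eq, Cycle.mem_coe_iff]
    exact List.mem_append_left _ hx
  exchange := by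
    rintro ⟨c, hc⟩ z Q y X ⟨m, hm⟩ hch hX hd
    simp only at hm
    subst hm
    by_contra hlt
    push Not at hlt
    have e : ∀ Q : List V, z :: (Q ++ [y]) ++ m = [] ++ z :: (Q ++ y :: m) := by simp
    have h1 := hc.1.1
    have h2 := hc.1.2.1
    have h3 := hc.1.2.2
    simp only [e] at h1 h2 hd
    have e' : ∀ Q : List V, z :: (Q ++ y :: m ++ [z]) = [] ++ z :: (Q ++ y :: (m ++ [z])) := by
      simp
    rw [List.nil_append, Cycle.chain_coe_cons, e', List.isChain_append_interior] at h1
    have := hc.2 (([] ++ z :: (X ++ y :: m) : List V) : Cycle V) ⟨?_, ?_, ?_⟩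
    · simp at this
      omega
    · rw [List.nil_append, Cycle.chain_coe_cons, e', List.isChain_append_interior]
      exact ⟨h1.1, hch, h1.2.2⟩
    · exact (Cycle.nodup_coe_iff.2 ((Cycle.nodup_coe_iff.1 h2).exchange_interior hX (by
        simpa using hd)))
    · simp at h3 ⊢
      omega

section Transition

variable [PartialOrder W] {S : V → Set W} {r : V → W}

theorem RootedRep.innerExcursion_of_infix (R : RootedRep G S r) {ι : Type*}
    {seg : ι → List V → Prop} {supp : ι → Set V} (E : ExchangeFamily G supp seg) {c : ι} {h : W}
    {l s t : List V} {u : V} (hseg : seg c l) (hl : l = s ++ u :: t) (hu : h ≤ r u)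
    (hs : ∃ x ∈ s, ¬ h ≤ r x) (ht : ∃ x ∈ t, ¬ h ≤ r x) :
    InnerExcursion r seg c h {u | h ∈ S u ∧ ¬ h ≤ r u} := by
  obtain ⟨z, w, X, z', hinf, hz, hz', hX⟩ :=
    List.exists_run_infix (p := fun x => h ≤ r x) hl hu hs ht
  have hseg' := E.infix_closed hseg hinf
  refine ⟨z, w :: X, z', hseg', ⟨?_, hz⟩, ⟨?_, hz'⟩, hX⟩
  · have : [z, w].IsChain G.Adj := (E.isChain hseg').infix ⟨[], X ++ [z'], by simp⟩
    exact R.mem_of_adj (u := w) (by simpa [G.adj_comm] using this) (hX w (by simp)) hz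
  · obtain ⟨Y, y, hY⟩ : ∃ Y y, w :: X = Y ++ [y] :=
      ⟨(w :: X).dropLast, (w :: X).getLast (by simp), (List.dropLast_append_getLast _).symm⟩
    rw [hY] at hseg' hX
    have : [y, z'].IsChain G.Adj := (E.isChain hseg').infix ⟨z :: Y, [], by simp⟩
    exact R.mem_of_adj (u := y) (by simpa using this) (hX y (by simp)) hz'

theorem RootedRep.innerExcursion_vertexCycle (R : RootedRep G S r) (h : W)
    (c : {c // G.LongestVertexCycle c}) (hu : ∃ u ∈ c.1, h ≤ r u)
    (hxy : ∃ x ∈ c.1, ∃ y ∈ c.1, x ≠ y ∧ ¬ h ≤ r x ∧ ¬ h ≤ r y) :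
    InnerExcursion r (fun c : {c // G.LongestVertexCycle c} => fun l => ∃ m : List V,
      c.1 = ↑(l ++ m)) c h {u | h ∈ S u ∧ ¬ h ≤ r u} := by
  obtain ⟨c, hc⟩ := c
  obtain ⟨u, huc, hu⟩ := hu
  obtain ⟨x, hx, y, hy, hne, hxh, hyh⟩ := hxy
  simp only at huc hx hy
  induction c using Quotient.inductionOn with
  | _ l =>
  simp only [Cycle.mk''_eq_coe, Cycle.mem_coe_iff] at huc hx hy
  obtain ⟨s, t, rfl⟩ := List.append_of_mem hx
  have hrot : (↑(s ++ x :: t) : Cycle V) = ↑(x :: (t ++ s)) := by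
    rw [Cycle.coe_eq_coe]
    simpa using List.isRotated_append (l := s) (l' := x :: t)
  have hu' : u ∈ t ++ s := by
    have : u ≠ x := by rintro rfl; exact hxh hu
    simp at huc ⊢; tauto
  have hy' : y ∈ t ++ s := by simp at hy ⊢; tauto
  obtain ⟨s', t', hst⟩ := List.append_of_mem hu'
  have hyu : y ≠ u := by rintro rfl; exact hyh hu
  rw [hst] at hy' hrot
  rcases List.mem_append.1 hy' with hy' | hy'
  · obtain ⟨a, b, rfl⟩ := List.append_of_mem hy'
    have hrot' : (↑(x :: ((a ++ y :: b) ++ u :: t')) : Cycle V) =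
        ↑((y :: b) ++ u :: (t' ++ x :: a)) := by
      rw [Cycle.coe_eq_coe]
      simpa using List.isRotated_append (l := x :: a) (l' := y :: b ++ u :: t')
    refine R.innerExcursion_of_infix (exchangeFamily_longestVertexCycle G)
      (l := (y :: b) ++ u :: (t' ++ x :: a)) ⟨[], ?_⟩ rfl hu ⟨y, by simp, hyh⟩ ⟨x, by simp, hxh⟩
    simp only [Cycle.mk''_eq_coe]
    rw [hrot, hrot', List.append_nil]
  · refine R.innerExcursion_of_infix (exchangeFamily_longestVertexCycle G)
      (l := (x :: s') ++ u :: t') ⟨[], ?_⟩ rfl hu ⟨x, by simp, hxh⟩ ⟨y, ?_, hyh⟩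
    · simp only [Cycle.mk''_eq_coe]
      rw [hrot, List.append_nil, List.cons_append]
    · simp at hy'; tauto

end Transition

end SimpleGraph

namespace SimpleGraph

variable {V : Type*} {W : Type*} {G : SimpleGraph V}

section PathTransition

variable [PartialOrder W] {S : V → Set W} {r : V → W}

theorem RootedRep.mem_of_isChain_append (R : RootedRep G S r) {h : W} {X T : List V} {a : V}
    (hch : (X ++ a :: T).IsChain G.Adj) (hX : X ≠ []) (hXh : ∀ x ∈ X, h ≤ r x) (ha : ¬ h ≤ r a) :
    h ∈ S a := by
  obtain ⟨Y, y, rfl⟩ : ∃ Y y, X = Y ++ [y] :=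
    ⟨X.dropLast, X.getLast hX, (List.dropLast_append_getLast _).symm⟩
  have : [y, a].IsChain G.Adj := hch.infix ⟨Y, T, by simp⟩
  exact R.mem_of_adj (u := y) (by simpa using this) (hXh y (by simp)) ha

theorem LongestPathList.length_le [Fintype V] {l : List V} (h : G.LongestPathList l) :
    l.length ≤ Fintype.card V := List.Nodup.length_le_card h.1.2

theorem RootedRep.exists_hitting_of_end [Finite V] (R : RootedRep G S r) (h : W) :
    ∃ H : Finset V, H.card ≤ 1 ∧ ∀ X Y, G.LongestPathList (X ++ Y) → X ≠ [] → Y ≠ [] →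
      (∀ x ∈ X, h ≤ r x) → (∀ y ∈ Y, ¬ h ≤ r y) → ∃ x ∈ H, x ∈ Y := by
  have := Fintype.ofFinite V
  set 𝒯 : Set (List V × List V) := {p | G.LongestPathList (p.1 ++ p.2) ∧ p.1 ≠ [] ∧ p.2 ≠ [] ∧
    (∀ x ∈ p.1, h ≤ r x) ∧ ∀ y ∈ p.2, ¬ h ≤ r y}
  rcases 𝒯.eq_empty_or_nonempty with h𝒯 | h𝒯
  · refine ⟨∅, by simp, fun X Y h1 h2 h3 h4 h5 => ?_⟩
    have : (X, Y) ∈ 𝒯 := ⟨h1, h2, h3, h4, h5⟩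
    rw [h𝒯] at this
    exact this.elim
  obtain ⟨⟨X₁, Y₁⟩, ⟨hl, hX, hY, hXh, hYh⟩, hmax⟩ := Set.exists_forall_le_of_nat_bounded
    (fun p : List V × List V => p.1.length) (N := Fintype.card V) (s := 𝒯) (by
      rintro p ⟨hp, _⟩
      have := hp.length_le
      simp at this
      omega) h𝒯
  simp only at hl hX hY hXh hYh
  cases Y₁ with
  | nil => exact absurd rfl hY
  | cons a T =>
  refine ⟨{a}, by simp, fun X Y h1 h2 h3 h4 h5 => ?_⟩
  have hlen : X.length ≤ X₁.length := hmax (X, Y) ⟨h1, h2, h3, h4, h5⟩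
  simp only [Finset.mem_singleton, exists_eq_left]
  by_contra haY
  cases Y with
  | nil => exact absurd rfl h3
  | cons z Z =>
  have hah := R.mem_of_isChain_append hl.1.1 hX hXh (hYh a (by simp))
  have hzh := R.mem_of_isChain_append h1.1.1 h2 h4 (h5 z (by simp))
  have haz : G.Adj a z := R.adj_of_mem hah hzh (by rintro rfl; simp at haY)
  have hc := h1.2 (X₁ ++ a :: z :: Z) (by
    rw [List.isChain_append_cons_cons]
    exact ⟨hl.1.1.infix ⟨[], T, by simp⟩, haz, h1.1.1.infix ⟨X, [], by simp⟩⟩) (by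
    rw [List.nodup_append', List.nodup_cons]
    refine ⟨hl.1.2.sublist (List.sublist_append_left _ _), ⟨haY,
      h1.1.2.sublist (List.sublist_append_right _ _)⟩, ?_⟩
    intro x hx hx'
    rcases List.mem_cons.1 hx' with rfl | hx'
    · exact hYh x (by simp) (hXh x hx)
    · exact h5 x hx' (hXh x hx))
  simp at hc
  omega

theorem RootedRep.exists_hitting_of_two_ends [Finite V] (R : RootedRep G S r) (h : W) :
    ∃ H : Finset V, H.card ≤ 2 ∧ ∀ X Y Z, G.LongestPathList (X ++ Y ++ Z) → X ≠ [] → Z ≠ [] →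
      2 ≤ Y.length → (∀ x ∈ X, h ≤ r x) → (∀ y ∈ Y, ¬ h ≤ r y) → (∀ x ∈ Z, h ≤ r x) →
      ∃ x ∈ H, x ∈ Y := by
  classical
  have := Fintype.ofFinite V
  have hform : ∀ Y : List V, 2 ≤ Y.length → ∃ a M b, Y = a :: (M ++ [b]) := by
    intro Y hY
    match Y with
    | a :: b :: M =>
      exact ⟨a, (b :: M).dropLast, (b :: M).getLast (by simp), by
        rw [List.dropLast_append_getLast]⟩
  set 𝒯 : Set (List V × List V × List V) := {p | G.LongestPathList (p.1 ++ p.2.1 ++ p.2.2) ∧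
    p.1 ≠ [] ∧ p.2.2 ≠ [] ∧ 2 ≤ p.2.1.length ∧ (∀ x ∈ p.1, h ≤ r x) ∧ (∀ y ∈ p.2.1, ¬ h ≤ r y) ∧
    ∀ x ∈ p.2.2, h ≤ r x}
  rcases 𝒯.eq_empty_or_nonempty with h𝒯 | h𝒯
  · refine ⟨∅, by simp, fun X Y Z h1 h2 h3 h4 h5 h6 h7 => ?_⟩
    have : (X, Y, Z) ∈ 𝒯 := ⟨h1, h2, h3, h4, h5, h6, h7⟩
    rw [h𝒯] at this
    exact this.elim
  obtain ⟨⟨X₁, Y₁, Z₁⟩, ⟨hl, hX, hZ, hY, hXh, hYh, hZh⟩, hmax⟩ :=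
    Set.exists_forall_le_of_nat_bounded
    (fun p : List V × List V × List V => p.1.length + p.2.2.length) (N := Fintype.card V) (s := 𝒯)
    (by
      rintro p ⟨hp, _⟩
      have := hp.length_le
      simp at this
      omega) h𝒯
  simp only at hl hX hY hXh hYh hZ hZh
  have hends : ∀ {X Z : List V} {a b : V} {M : List V},
      (X ++ (a :: (M ++ [b])) ++ Z).IsChain G.Adj → X ≠ [] → Z ≠ [] → (∀ x ∈ X, h ≤ r x) →
      (∀ y ∈ a :: (M ++ [b]), ¬ h ≤ r y) → (∀ x ∈ Z, h ≤ r x) → h ∈ S a ∧ h ∈ S b := by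
    intro X Z a b M hc hX hZ hXh hYh hZh
    refine ⟨R.mem_of_isChain_append (T := M ++ [b] ++ Z) (by simpa using hc) hX hXh
      (hYh a (by simp)), ?_⟩
    cases Z with
    | nil => exact absurd rfl hZ
    | cons z Z =>
    have : [b, z].IsChain G.Adj := hc.infix ⟨X ++ a :: M, Z, by simp⟩
    exact R.mem_of_adj (u := z) (by simpa [G.adj_comm] using this) (hZh z (by simp))
      (hYh b (by simp))
  obtain ⟨a, M₁, b, rfl⟩ := hform Y₁ hY
  obtain ⟨ha, hb⟩ := hends hl.1.1 hX hZ hXh hYh hZh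
  refine ⟨{a, b}, Finset.card_le_two, fun X Y Z h1 h2 h3 h4 h5 h6 h7 => ?_⟩
  have hlen : X.length + Z.length ≤ X₁.length + Z₁.length :=
    hmax (X, Y, Z) ⟨h1, h2, h3, h4, h5, h6, h7⟩
  obtain ⟨z, M, z', rfl⟩ := hform Y h4
  obtain ⟨hz, hz'⟩ := hends h1.1.1 h2 h3 h5 h6 h7
  by_contra hcon
  simp only [Finset.mem_insert, Finset.mem_singleton, exists_eq_or_imp, exists_eq_left,
    not_or] at hcon
  obtain ⟨haY, hbY⟩ := hcon
  have haz : G.Adj a z := R.adj_of_mem ha hz (by rintro rfl; simp at haY)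
  have hzb : G.Adj z' b := R.adj_of_mem hz' hb (by rintro rfl; simp at hbY)
  have hnd := hl.1.2
  have hnd' := h1.1.2
  have hc := h1.2 (X₁ ++ a :: z :: (M ++ z' :: b :: Z₁)) (by
    rw [List.isChain_append_cons_cons]
    refine ⟨hl.1.1.infix ⟨[], M₁ ++ [b] ++ Z₁, by simp⟩, haz, ?_⟩
    rw [← List.cons_append, List.isChain_append_cons_cons]
    exact ⟨h1.1.1.infix ⟨X, Z, by simp⟩, hzb, hl.1.1.infix ⟨X₁ ++ a :: M₁, [], by simp⟩⟩) (by
    have hperm : (X₁ ++ a :: z :: (M ++ z' :: b :: Z₁)).Perm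
        ((z :: (M ++ [z'])) ++ (X₁ ++ [a, b] ++ Z₁)) := by
      rw [List.perm_iff_count]
      intro x
      simp [List.count_cons]
      omega
    rw [hperm.nodup_iff, List.nodup_append']
    refine ⟨hnd'.sublist ((List.sublist_append_right _ _).trans (List.sublist_append_left _ _)),
      hnd.sublist ?_, ?_⟩
    · refine List.Sublist.append_right (List.Sublist.append_left ?_ _) _
      exact List.Sublist.cons_cons _ (List.sublist_append_right _ _)
    · intro x hx hx'
      have hxh := h6 x hx
      simp only [List.mem_append, List.mem_cons, List.not_mem_nil, or_false] at hx'
      rcases hx' with (hx' | rfl | rfl) | hx'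
      · exact hxh (hXh x hx')
      · exact haY hx
      · exact hbY hx
      · exact hxh (hZh x hx'))
  simp at hc
  omega

theorem RootedRep.exists_hitting_or_innerExcursion [Finite V] (R : RootedRep G S r) (h : W) :
    ∃ H : Finset V, H.card ≤ 3 ∧ ∀ c : {l // G.LongestPathList l}, (∀ x ∈ H, x ∉ c.1) →
      (∃ u ∈ c.1, h ≤ r u) → (∃ x ∈ c.1, ∃ y ∈ c.1, x ≠ y ∧ ¬ h ≤ r x ∧ ¬ h ≤ r y) →
      InnerExcursion r (fun (c : {l // G.LongestPathList l}) (l : List V) => l <:+: c.1) c h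
        {u | h ∈ S u ∧ ¬ h ≤ r u} := by
  classical
  obtain ⟨H₁, hH₁, hH₁'⟩ := R.exists_hitting_of_end h
  obtain ⟨H₂, hH₂, hH₂'⟩ := R.exists_hitting_of_two_ends h
  refine ⟨H₁ ∪ H₂, (Finset.card_union_le _ _).trans (by omega), ?_⟩
  rintro ⟨c, hc⟩ hmiss ⟨u, huc, hu⟩ ⟨x, hx, y, hy, hxy, hxh, hyh⟩
  simp only at hmiss huc hx hy
  by_contra hcon
  have key : ∀ s w t, c = s ++ w :: t → h ≤ r w → (∃ x ∈ s, ¬ h ≤ r x) →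
      (∃ x ∈ t, ¬ h ≤ r x) → False := fun s w t hst hw h1 h2 =>
    hcon (R.innerExcursion_of_infix (exchangeFamily_longestPathList G) (List.infix_refl c) hst hw
      h1 h2)
  have hmiss₁ : ∀ x ∈ H₁, x ∉ c := fun x hx => hmiss x (Finset.mem_union_left _ hx)
  have hmiss₂ : ∀ x ∈ H₂, x ∉ c := fun x hx => hmiss x (Finset.mem_union_right _ hx)
  obtain ⟨X, a, T, rfl, ha, hX⟩ :=
    List.exists_eq_append_cons_of_exists (p := fun x => ¬ h ≤ r x) (l := c) ⟨x, hx, hxh⟩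
  push Not at hX
  obtain ⟨Y, b, Z, hYZ, hb, hZ⟩ :=
    List.exists_eq_append_cons_of_exists_last (p := fun x => ¬ h ≤ r x) (l := a :: T)
      ⟨a, by simp, ha⟩
  push Not at hZ
  have hYout : ∀ w ∈ Y ++ [b], ¬ h ≤ r w := by
    intro w hw hwh
    have hwY : w ∈ Y := by
      rcases List.mem_append.1 hw with hw | hw
      · exact hw
      · rw [List.mem_singleton.1 hw] at hwh; exact absurd hwh hb
    obtain ⟨Y₁, Y₂, rfl⟩ := List.append_of_mem hwY
    cases Y₁ with
    | nil =>
      simp only [List.nil_append, List.cons_append, List.cons.injEq] at hYZ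
      exact ha (hYZ.1 ▸ hwh)
    | cons a' Y₁ =>
      have haa : a = a' := by simp at hYZ; exact hYZ.1
      exact key (X ++ a' :: Y₁) w (Y₂ ++ b :: Z) (by rw [hYZ]; simp) hwh
        ⟨a, by simp [haa], ha⟩ ⟨b, by simp, hb⟩
  have hform : X ++ a :: T = X ++ (Y ++ [b]) ++ Z := by rw [hYZ]; simp
  rw [hform] at huc hx hy hc hmiss₁ hmiss₂
  have hlen : 2 ≤ (Y ++ [b]).length := by
    have hmem : ∀ w ∈ X ++ (Y ++ [b]) ++ Z, ¬ h ≤ r w → w ∈ Y ++ [b] := by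
      intro w hw hwh
      simp only [List.mem_append] at hw ⊢
      rcases hw with (hw | hw) | hw
      · exact absurd (hX w hw) hwh
      · exact hw
      · exact absurd (hZ w hw) hwh
    have h1 := hmem x hx hxh
    have h2 := hmem y hy hyh
    cases Y with
    | nil => simp at h1 h2; exact absurd (h1.trans h2.symm) hxy
    | cons _ _ => simp
  by_cases hX0 : X = []
  · by_cases hZ0 : Z = []
    · subst hX0 hZ0
      simp only [List.nil_append, List.append_nil] at huc
      exact hYout u huc hu
    · subst hX0
      obtain ⟨w, hw, hw'⟩ := hH₁' Z.reverse (Y ++ [b]).reverse (by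
        have := hc.reverse
        simpa using this) (by simpa using hZ0) (by simp) (by simpa using hZ) (by
        intro y hy; exact hYout y (List.mem_reverse.1 hy))
      exact hmiss₁ w hw (by simp at hw' ⊢; tauto)
  · by_cases hZ0 : Z = []
    · subst hZ0
      obtain ⟨w, hw, hw'⟩ := hH₁' X (Y ++ [b]) (by simpa using hc) hX0 (by simp) hX hYout
      exact hmiss₁ w hw (by simp at hw' ⊢; tauto)
    · obtain ⟨w, hw, hw'⟩ := hH₂' X (Y ++ [b]) Z hc hX0 hZ0 hlen hX hYout hZ
      exact hmiss₂ w hw (by simp at hw' ⊢; tauto)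

end PathTransition

end SimpleGraph

namespace List

variable {α : Type*}

theorem exists_eq_of_not_nodup {l : List α} (h : ¬ l.Nodup) :
    ∃ a s m t, l = s ++ a :: (m ++ a :: t) := by
  induction l with
  | nil => simp at h
  | cons x l ih =>
    by_cases hx : x ∈ l
    · obtain ⟨m, t, rfl⟩ := List.append_of_mem hx
      exact ⟨x, [], m, t, by simp⟩
    · obtain ⟨a, s, m, t, rfl⟩ := ih (fun h' => h (List.nodup_cons.2 ⟨hx, h'⟩))
      exact ⟨a, x :: s, m, t, by simp⟩

end List

namespace SimpleGraph

variable {V : Type*} {G : SimpleGraph V}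

/-- The vertex sequence of a path from `X` to `Y` that meets `X` only at its start and `Y` only at
its end. -/
structure IsLink (G : SimpleGraph V) (X Y : Set V) (l : List V) : Prop where
  isChain : l.IsChain G.Adj
  nodup : l.Nodup
  start : ∃ a m, l = a :: m ∧ a ∈ X ∧ ∀ u ∈ m, u ∉ X
  finish : ∃ m b, l = m ++ [b] ∧ b ∈ Y ∧ ∀ u ∈ m, u ∉ Y

theorem exists_shortest_isLink {U X Y : Set V} (hU : (G.induce U).Preconnected) {x y : V}
    (hx : x ∈ X) (hxU : x ∈ U) (hy : y ∈ Y) (hyU : y ∈ U) :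
    ∃ l, G.IsLink X Y l ∧ (∀ u ∈ l, u ∈ U) ∧
      ∀ l', G.IsLink X Y l' → (∀ u ∈ l', u ∈ U) → l.length ≤ l'.length := by
  let P : List V → Prop := fun l => l.IsChain G.Adj ∧ (∀ u ∈ l, u ∈ U) ∧
    (∃ a m, l = a :: m ∧ a ∈ X) ∧ ∃ m b, l = m ++ [b] ∧ b ∈ Y
  have hex : ∃ n l, P l ∧ l.length = n := by
    obtain ⟨p⟩ := hU ⟨x, hxU⟩ ⟨y, hyU⟩
    refine ⟨_, p.support.map Subtype.val, ⟨?_, ?_, ?_, ?_⟩, rfl⟩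
    · rw [List.isChain_map]
      exact p.isChain_adj_support
    · intro u hu
      obtain ⟨w, _, rfl⟩ := List.mem_map.1 hu
      exact w.2
    · exact ⟨x, p.support.tail.map Subtype.val, by rw [← List.map_cons (f := Subtype.val)
        (a := ⟨x, hxU⟩), Walk.cons_tail_support], hx⟩
    · refine ⟨p.support.dropLast.map Subtype.val, y, ?_, hy⟩
      have e := congrArg (List.map Subtype.val) (List.dropLast_append_getLast p.support_ne_nil)
      rw [List.map_append, Walk.getLast_support] at e
      exact e.symm
  classical
  obtain ⟨l, ⟨hch, hlU, ⟨a, m, hl, ha⟩, ⟨m', b, hl', hb⟩⟩, hn⟩ := Nat.find_spec hex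
  have hmin : ∀ l', P l' → l.length ≤ l'.length := fun l' hl' =>
    hn ▸ Nat.find_min' hex ⟨l', hl', rfl⟩
  refine ⟨l, ⟨hch, ?_, ⟨a, m, hl, ha, ?_⟩, ⟨m', b, hl', hb, ?_⟩⟩, hlU, fun l' h1 h2 => by
    obtain ⟨a, k, hk, ha, -⟩ := h1.start
    obtain ⟨k', b, hk', hb, -⟩ := h1.finish
    exact hmin l' ⟨h1.isChain, h2, ⟨a, k, hk, ha⟩, k', b, hk', hb⟩⟩
  · by_contra hnd
    obtain ⟨c, s, k, t, rfl⟩ := List.exists_eq_of_not_nodup hnd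
    have := hmin (s ++ c :: t) ⟨?_, ?_, ?_, ?_⟩
    · simp at this
      omega
    · rw [List.isChain_split] at hch ⊢
      exact ⟨hch.1, hch.2.infix ⟨c :: k, [], by simp⟩⟩
    · intro u hu
      exact hlU u (by simp at hu ⊢; tauto)
    · cases s with
      | nil =>
        simp at hl
        exact ⟨c, t, by simp, hl.1 ▸ ha⟩
      | cons d s =>
        simp at hl
        exact ⟨d, s ++ c :: t, by simp, hl.1 ▸ ha⟩
    · refine ⟨(s ++ c :: t).dropLast, (s ++ c :: t).getLast (by simp),
        (List.dropLast_append_getLast _).symm, ?_⟩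
      have h1 : (s ++ c :: (k ++ c :: t)).getLast (by simp) = b := by
        simp only [hl', List.getLast_append_singleton]
      have h2 : (s ++ c :: (k ++ c :: t)).getLast (by simp) =
          (s ++ c :: t).getLast (by simp) := by
        rw [List.getLast_append_of_ne_nil (by simp) (by simp),
          List.getLast_append_of_ne_nil (by simp) (by simp), List.getLast_cons (by simp),
          List.getLast_append_of_ne_nil (by simp) (by simp)]
      rw [← h2, h1]
      exact hb
  · intro u hu huX
    obtain ⟨s, t, rfl⟩ := List.append_of_mem hu
    have := hmin (u :: t) ⟨?_, ?_, ⟨u, t, rfl, huX⟩, ?_⟩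
    · simp [hl] at this
      omega
    · exact hch.infix ⟨a :: s, [], by simp [hl]⟩
    · intro w hw
      exact hlU w (by rw [hl]; simp at hw ⊢; tauto)
    · refine ⟨(u :: t).dropLast, (u :: t).getLast (by simp),
        (List.dropLast_append_getLast _).symm, ?_⟩
      have h1 : (a :: (s ++ u :: t)).getLast (by simp) = b := by
        simp only [← hl, hl', List.getLast_append_singleton]
      rw [List.getLast_cons (by simp), List.getLast_append_of_ne_nil (by simp) (by simp)] at h1
      rw [h1]
      exact hb
  · intro u hu huY
    obtain ⟨s, t, rfl⟩ := List.append_of_mem hu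
    have := hmin (s ++ [u]) ⟨?_, ?_, ?_, ⟨s, u, rfl, huY⟩⟩
    · simp [hl'] at this
    · exact hch.infix ⟨[], t ++ [b], by simp [hl']⟩
    · intro w hw
      exact hlU w (by rw [hl']; simp at hw ⊢; tauto)
    · cases s with
      | nil =>
        have : a = u := by rw [hl'] at hl; simp at hl; exact hl.1.symm
        exact ⟨u, [], by simp, this ▸ ha⟩
      | cons d s =>
        have : a = d := by rw [hl'] at hl; simp at hl; exact hl.1.symm
        exact ⟨d, s ++ [u], by simp, this ▸ ha⟩

theorem exists_isLink {U X Y : Set V} (hU : (G.induce U).Preconnected) {x y : V} (hx : x ∈ X)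
    (hxU : x ∈ U) (hy : y ∈ Y) (hyU : y ∈ U) : ∃ l, G.IsLink X Y l ∧ ∀ u ∈ l, u ∈ U := by
  obtain ⟨l, hl, hlU, -⟩ := exists_shortest_isLink hU hx hxU hy hyU
  exact ⟨l, hl, hlU⟩

theorem IsLink.append_of_mem {X X' Y T : Set V} {Z L m L₁ L₂ : List V} {w : V}
    (hZ : G.IsLink X T Z) (hL : G.IsLink X' Y L) (hm : Z = m ++ [w]) (hLw : L = L₁ ++ w :: L₂)
    (hmL : ∀ u ∈ m, u ∉ L) (hmY : ∀ u ∈ m, u ∉ Y) (hX : ∀ u ∈ L₂, u ∉ X) :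
    G.IsLink X Y (Z ++ L₂) := by
  have hmem : ∀ u ∈ w :: L₂, u ∈ L := fun u hu => by rw [hLw]; exact List.mem_append_right _ hu
  have hnd : (w :: L₂).Nodup := by
    have := hL.nodup
    rw [hLw] at this
    exact this.sublist (List.sublist_append_right _ _)
  refine ⟨?_, ?_, ?_, ?_⟩
  · rw [hm, List.append_assoc, List.singleton_append, List.isChain_split, ← hm]
    exact ⟨hZ.isChain, hL.isChain.infix ⟨L₁, [], by simp [hLw]⟩⟩
  · have h1 := hZ.nodup
    rw [hm, List.append_assoc, List.singleton_append, List.nodup_append']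
    refine ⟨h1.sublist (by rw [hm]; exact List.sublist_append_left _ _), hnd, ?_⟩
    intro u hu hu'
    exact hmL u hu (hmem u hu')
  · obtain ⟨a, k, hk, ha, hka⟩ := hZ.start
    refine ⟨a, k ++ L₂, by simp [hk], ha, ?_⟩
    intro u hu
    rcases List.mem_append.1 hu with hu | hu
    · exact hka u hu
    · exact hX u hu
  · obtain ⟨k, b, hk, hb, hkb⟩ := hL.finish
    rcases List.eq_nil_or_concat L₂ with rfl | ⟨K, b', rfl⟩
    · rw [hLw] at hk
      obtain ⟨_, rfl⟩ : L₁ = k ∧ w = b := by simpa using hk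
      exact ⟨m, w, by simp [hm], hb, hmY⟩
    · rw [hLw] at hk
      have hk' : (L₁ ++ w :: K) ++ [b'] = k ++ [b] := by simpa using hk
      obtain ⟨h1, h2⟩ := List.append_inj' hk' rfl
      obtain rfl : b' = b := by simpa using h2
      refine ⟨Z ++ K, b', by simp, hb, ?_⟩
      intro u hu
      rw [hm, List.append_assoc] at hu
      rcases List.mem_append.1 hu with hu | hu
      · exact hmY u hu
      · refine hkb u ?_
        rw [← h1]
        exact List.mem_append_right _ hu

theorem IsLink.cons {X Y : Set V} {P : List V} {r₀ r₁ : V} (hP : G.IsLink (insert r₁ X) Y P)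
    (hr₀ : r₀ ∈ X) (hr₁ : r₁ ∉ X) (hadj : G.Adj r₀ r₁) (hY : r₀ ∉ Y) (hmem : r₁ ∈ P) :
    G.IsLink X Y (r₀ :: P) ∧ ∀ u ∈ P, u ∉ X := by
  obtain ⟨a, m, rfl, ha, hm⟩ := hP.start
  have har : a = r₁ := by
    rcases List.mem_cons.1 hmem with h | h
    · exact h.symm
    · exact absurd (Set.mem_insert _ _) (hm r₁ h)
  subst har
  have hPX : ∀ u ∈ a :: m, u ∉ X := by
    intro u hu
    rcases List.mem_cons.1 hu with rfl | hu
    · exact hr₁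
    · exact fun h => hm u hu (Set.mem_insert_of_mem _ h)
  refine ⟨⟨List.isChain_cons_cons.2 ⟨hadj, hP.isChain⟩, List.nodup_cons.2
    ⟨fun h => hPX _ h hr₀, hP.nodup⟩, ⟨r₀, a :: m, rfl, hr₀, hPX⟩, ?_⟩, hPX⟩
  obtain ⟨k, b, hk, hb, hkb⟩ := hP.finish
  refine ⟨r₀ :: k, b, by simp [hk], hb, ?_⟩
  intro u hu
  rcases List.mem_cons.1 hu with rfl | hu
  · exact hY
  · exact hkb u hu

theorem IsLink.of_insert {X Y : Set V} {P : List V} {r₁ : V} (hP : G.IsLink (insert r₁ X) Y P)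
    (hmem : r₁ ∉ P) : G.IsLink X Y P := by
  obtain ⟨a, m, rfl, ha, hm⟩ := hP.start
  refine ⟨hP.isChain, hP.nodup, ⟨a, m, rfl, ?_, fun u hu h => hm u hu (Set.mem_insert_of_mem _ h)⟩,
    hP.finish⟩
  exact ha.resolve_left (by rintro rfl; simp at hmem)

/-- In a graph without cut vertices, any two sets of at least two vertices are joined by two
disjoint paths. -/
theorem exists_two_disjoint_isLink [Finite V]
    (hG : ∀ s : V, (G.induce {v | v ≠ s}).Preconnected) {X Y : Set V} (hX : X.Nontrivial)
    (hY : Y.Nontrivial) : ∃ P Q, G.IsLink X Y P ∧ G.IsLink X Y Q ∧ P.Disjoint Q ∧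
      ((X ∩ Y).Subsingleton → ∀ w ∈ X ∩ Y, w ∈ P) := by
  induction hn : Xᶜ.ncard using Nat.strong_induction_on generalizing X with
  | _ n ih =>
  by_cases hXY : ∃ x, x ∈ X ∩ Y
  · obtain ⟨x, hxX, hxY⟩ := hXY
    obtain ⟨x', hx', hxx'⟩ := hX.exists_ne x
    obtain ⟨y', hy', hxy'⟩ := hY.exists_ne x
    obtain ⟨Z, hZ, hZx⟩ := exists_isLink (hG x) (X := X \ {x}) (Y := Y \ {x}) ⟨hx', hxx'⟩ hxx'
      ⟨hy', hxy'⟩ hxy'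
    refine ⟨[x], Z, ⟨by simp, by simp, ⟨x, [], rfl, hxX, by simp⟩, ⟨[], x, rfl, hxY, by simp⟩⟩,
      ⟨hZ.isChain, hZ.nodup, ?_, ?_⟩, ?_, ?_⟩
    · obtain ⟨a, m, hm, ha, hma⟩ := hZ.start
      exact ⟨a, m, hm, ha.1, fun u hu h => hma u hu ⟨h, hZx u (by simp [hm, hu])⟩⟩
    · obtain ⟨m, b, hm, hb, hmb⟩ := hZ.finish
      exact ⟨m, b, hm, hb.1, fun u hu h => hmb u hu ⟨h, hZx u (by simp [hm, hu])⟩⟩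
    · intro u hu hu'
      exact hZx u hu' (by simpa using hu)
    · intro hs w hw
      simpa using hs hw ⟨hxX, hxY⟩
  · have hdisj : ∀ x ∈ X, x ∉ Y := fun x hx hxY => hXY ⟨x, hx, hxY⟩
    obtain ⟨x, hx, x', hx', hxx'⟩ := hX
    obtain ⟨y, hy⟩ := hY.nonempty
    obtain ⟨r₀, r₁, hr₀, hr₁, hadj⟩ : ∃ r₀ r₁, r₀ ∈ X ∧ r₁ ∉ X ∧ G.Adj r₀ r₁ := by
      obtain ⟨p⟩ := hG x' ⟨x, hxx'⟩ ⟨y, by rintro rfl; exact hdisj y hx' hy⟩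
      obtain ⟨d, _, h1, h2⟩ := p.exists_boundary_dart {u | u.1 ∈ X} hx
        (fun h => hdisj y h hy)
      exact ⟨d.fst, d.snd, h1, h2, d.adj⟩
    have hgoal : ∃ P Q, G.IsLink X Y P ∧ G.IsLink X Y Q ∧ P.Disjoint Q := by
      obtain ⟨P, Q, hP, hQ, hPQ, _⟩ := ih (insert r₁ X)ᶜ.ncard (by
        rw [← hn]
        refine Set.ncard_lt_ncard ?_ (Set.toFinite _)
        exact compl_lt_compl_iff_lt.2 (Set.ssubset_insert hr₁)) (X := insert r₁ X)
        ⟨x, Set.mem_insert_of_mem _ hx, x', Set.mem_insert_of_mem _ hx', hxx'⟩ rfl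
      have main : ∀ P Q, G.IsLink (insert r₁ X) Y P → G.IsLink (insert r₁ X) Y Q →
          P.Disjoint Q → r₁ ∈ P → ∃ P Q, G.IsLink X Y P ∧ G.IsLink X Y Q ∧ P.Disjoint Q := by
        intro P Q hP hQ hPQ hr₁P
        obtain ⟨hP', hPX⟩ := hP.cons hr₀ hr₁ hadj (hdisj _ hr₀) hr₁P
        have hQ' := hQ.of_insert (fun h => hPQ hr₁P h)
        by_cases hr₀Q : r₀ ∈ Q
        · obtain ⟨q, k, hqk, hq, hk⟩ := hQ'.start
          have hqr : q = r₀ := by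
            rw [hqk] at hr₀Q
            rcases List.mem_cons.1 hr₀Q with h | h
            · exact h.symm
            · exact absurd hr₀ (hk _ h)
          subst hqr
          obtain ⟨x'', hx'', hx''q⟩ : ∃ x'' ∈ X, x'' ≠ q := by
            by_cases h : x = q
            · exact ⟨x', hx', by rw [← h]; exact hxx'.symm⟩
            · exact ⟨x, hx, h⟩
          obtain ⟨Z, hZ, hZq⟩ := exists_isLink (hG q) (X := X \ {q})
            (Y := {w | w ∈ Y ∨ w ∈ P ∨ w ∈ Q} \ {q}) ⟨hx'', hx''q⟩ hx''q
            (y := y) ⟨Or.inl hy, by rintro rfl; exact hdisj _ hr₀ hy⟩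
            (by rintro rfl; exact hdisj _ hr₀ hy)
          have hZX : G.IsLink X ({w | w ∈ Y ∨ w ∈ P ∨ w ∈ Q} \ {q}) Z := by
            refine ⟨hZ.isChain, hZ.nodup, ?_, hZ.finish⟩
            obtain ⟨a, m, hm, ha, hma⟩ := hZ.start
            exact ⟨a, m, hm, ha.1, fun u hu h => hma u hu ⟨h, hZq u (by simp [hm, hu])⟩⟩
          obtain ⟨m, w, hm, ⟨hw, hwq⟩, hmw⟩ := hZ.finish
          have hm' : ∀ u ∈ m, u ∉ Y ∧ u ∉ P ∧ u ∉ Q := by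
            intro u hu
            have h1 := hmw u hu
            have h2 := hZq u (by simp [hm, hu])
            refine ⟨fun h => h1 ⟨Or.inl h, h2⟩, fun h => h1 ⟨Or.inr (Or.inl h), h2⟩,
              fun h => h1 ⟨Or.inr (Or.inr h), h2⟩⟩
          by_cases hwQ : w ∈ Q
          · obtain ⟨Q₁, Q₂, hQ₁₂⟩ := List.append_of_mem hwQ
            have hQ₁ : ∃ d Q₁', Q₁ = d :: Q₁' := by
              cases Q₁ with
              | nil =>
                rw [hqk] at hQ₁₂
                simp at hQ₁₂
                exact absurd hQ₁₂.1.symm hwq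
              | cons d Q₁' => exact ⟨d, Q₁', rfl⟩
            obtain ⟨d, Q₁', rfl⟩ := hQ₁
            have hk' : ∀ u ∈ w :: Q₂, u ∈ k := by
              rw [hqk] at hQ₁₂
              simp only [List.cons_append, List.cons.injEq] at hQ₁₂
              intro u hu
              rw [hQ₁₂.2]
              exact List.mem_append_right _ hu
            refine ⟨_, _, hP', hZX.append_of_mem hQ' hm hQ₁₂ (fun u hu => (hm' u hu).2.2)
              (fun u hu => (hm' u hu).1) (fun u hu => hk u (hk' u (List.mem_cons_of_mem _ hu))), ?_⟩
            have hqk' : ∀ u ∈ w :: Q₂, u ≠ q := by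
              rintro u hu rfl
              exact hk _ (hk' _ hu) hr₀
            intro u hu hu'
            have hu'' : u ∈ m ∨ u ∈ w :: Q₂ := by
              rw [hm, List.append_assoc] at hu'
              exact List.mem_append.1 hu'
            rcases List.mem_cons.1 hu with rfl | hu
            · rcases hu'' with h | h
              · exact (hm' _ h).2.2 (by simp [hqk])
              · exact hqk' _ h rfl
            · rcases hu'' with h | h
              · exact (hm' u h).2.1 hu
              · exact hPQ hu (by rw [hqk]; exact List.mem_cons_of_mem _ (hk' u h))
          · by_cases hwP : w ∈ P
            · obtain ⟨P₁, P₂, hP₁₂⟩ := List.append_of_mem hwP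
              refine ⟨_, _, hZX.append_of_mem hP hm hP₁₂ (fun u hu => (hm' u hu).2.1)
                (fun u hu => (hm' u hu).1) (fun u hu => hPX u (by simp [hP₁₂, hu])), hQ', ?_⟩
              intro u hu hu'
              rcases List.mem_append.1 hu with hu | hu
              · rw [hm] at hu
                rcases List.mem_append.1 hu with h | h
                · exact (hm' u h).2.2 hu'
                · rw [List.mem_singleton.1 h] at hu'
                  exact hwQ hu'
              · exact hPQ (by rw [hP₁₂]; simp [hu]) hu'
            · have hwY : w ∈ Y := by
                rcases hw with h | h | h
                · exact h
                · exact absurd h hwP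
                · exact absurd h hwQ
              refine ⟨Z, Q, ⟨hZX.isChain, hZX.nodup, hZX.start,
                ⟨m, w, hm, hwY, fun u hu => (hm' u hu).1⟩⟩, hQ', ?_⟩
              intro u hu hu'
              rw [hm] at hu
              rcases List.mem_append.1 hu with h | h
              · exact (hm' u h).2.2 hu'
              · rw [List.mem_singleton.1 h] at hu'
                exact hwQ hu'
        · refine ⟨_, _, hP', hQ', ?_⟩
          intro u hu hu'
          rcases List.mem_cons.1 hu with rfl | hu
          · exact hr₀Q hu'
          · exact hPQ hu hu'
      by_cases h1 : r₁ ∈ P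
      · exact main P Q hP hQ hPQ h1
      · by_cases h2 : r₁ ∈ Q
        · exact main Q P hQ hP hPQ.symm h2
        · exact ⟨P, Q, hP.of_insert h1, hQ.of_insert h2, hPQ⟩
    obtain ⟨P, Q, hP, hQ, hPQ⟩ := hgoal
    exact ⟨P, Q, hP, hQ, hPQ, fun _ w hw => absurd ⟨w, hw⟩ hXY⟩

end SimpleGraph

namespace SimpleGraph

variable {V : Type*} {G : SimpleGraph V}

theorem LongestPathList.exists_mem_inter [Nonempty V] (hG : G.Preconnected) {c c' : List V}
    (hc : G.LongestPathList c) (hc' : G.LongestPathList c') : ∃ x ∈ c, x ∈ c' := by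
  by_contra hcon
  push Not at hcon
  have hne : ∀ c, G.LongestPathList c → ∃ x, x ∈ c := by
    intro c hc
    obtain ⟨v⟩ := ‹Nonempty V›
    have := hc.2 [v] (by simp) (by simp)
    exact List.exists_mem_of_length_pos (by simpa [Nat.one_le_iff_ne_zero, Nat.pos_iff_ne_zero] using this)
  obtain ⟨x, hx⟩ := hne c hc
  obtain ⟨y, hy⟩ := hne c' hc'
  have hpre : (G.induce Set.univ).Preconnected :=
    (Iso.preconnected_iff (induceUnivIso G)).2 hG
  obtain ⟨l, hl, -⟩ := exists_isLink hpre (X := {u | u ∈ c}) (Y := {u | u ∈ c'}) hx trivial hy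
    trivial
  obtain ⟨a, m, hlm, ha, hma⟩ := hl.start
  obtain ⟨m', b, hlm', hb, hmb⟩ := hl.finish
  simp only [Set.mem_ofPred_eq] at ha hma hb hmb
  obtain ⟨M, rfl⟩ : ∃ M, m = M ++ [b] := by
    rcases List.eq_nil_or_concat m with rfl | ⟨M, b', rfl⟩
    · rw [hlm'] at hlm
      have : m' = [] ∧ b = a := by simpa [List.append_eq_cons_iff] using hlm
      exact absurd hb (this.2 ▸ hcon a ha)
    · refine ⟨M, ?_⟩
      rw [hlm'] at hlm
      have h1 : m' ++ [b] = (a :: M) ++ [b'] := by simpa using hlm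
      rw [(List.append_inj' h1 rfl).2]
      simp
  have hM : ∀ u ∈ a :: M, u ∉ c' := by
    have : m' = a :: M := (List.append_inj' (s₁ := m') (s₂ := a :: M) (t₁ := [b]) (t₂ := [b])
      (by rw [← hlm', hlm]; simp) rfl).1
    exact this ▸ hmb
  have hch := hl.isChain
  have hnd := hl.nodup
  rw [hlm] at hch hnd
  have main : ∀ s t s' t', G.LongestPathList (s ++ a :: t) → G.LongestPathList (s' ++ b :: t') →
      (∀ x, x ∈ s ++ a :: t ↔ x ∈ c) → (∀ x, x ∈ s' ++ b :: t' ↔ x ∈ c') →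
      t.length ≤ s.length → s'.length ≤ t'.length → False := by
    intro s t s' t' h h' hmem hmem' hs hs'
    have := h.2 (s ++ a :: (M ++ b :: t')) (by
      rw [List.isChain_append_interior]
      exact ⟨h.1.1.infix ⟨[], t, by simp⟩, hch, h'.1.1.infix ⟨s', [], by simp⟩⟩) (by
      have hperm : (s ++ a :: (M ++ b :: t')).Perm (s ++ ((a :: (M ++ [b])) ++ t')) := by simp
      rw [hperm.nodup_iff, List.nodup_append', List.nodup_append']
      refine ⟨h.1.2.sublist (List.sublist_append_left _ _), ⟨hnd, ?_, ?_⟩, ?_⟩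
      · exact h'.1.2.sublist ((List.sublist_cons_self _ _).trans (List.sublist_append_right _ _))
      · intro u hu hu'
        have hu'' : u ∈ c' := (hmem' u).1 (by simp [hu'])
        rw [← List.cons_append] at hu
        rcases List.mem_append.1 hu with hu | hu
        · exact hM u hu hu''
        · rw [List.mem_singleton.1 hu] at hu'
          have := h'.1.2.sublist (List.sublist_append_right _ _)
          exact (List.nodup_cons.1 this).1 hu'
      · intro u hu hu'
        have hu'' : u ∈ c := (hmem u).1 (by simp [hu])
        rcases List.mem_append.1 hu' with hu' | hu'
        · rcases List.mem_cons.1 hu' with rfl | hu'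
          · have := h.1.2
            rw [List.nodup_append'] at this
            exact this.2.2 hu (by simp)
          · exact hma u hu' hu''
        · exact hcon u hu'' ((hmem' u).1 (by simp [hu'])))
    have h1 := h'.2 _ h.1.1 h.1.2
    simp at this h1
    omega
  have hor : ∀ c, G.LongestPathList c → ∀ a ∈ c, ∃ s t, G.LongestPathList (s ++ a :: t) ∧
      (∀ x, x ∈ s ++ a :: t ↔ x ∈ c) ∧ t.length ≤ s.length := by
    intro c hc a ha
    obtain ⟨s, t, rfl⟩ := List.append_of_mem ha
    rcases le_total t.length s.length with h | h
    · exact ⟨s, t, hc, fun x => Iff.rfl, h⟩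
    · refine ⟨t.reverse, s.reverse, by simpa using hc.reverse, fun x => ?_, by simpa using h⟩
      simp
      tauto
  obtain ⟨s, t, h1, h2, h3⟩ := hor c hc a ha
  obtain ⟨s', t', h1', h2', h3'⟩ := hor c' hc' b hb
  exact main s t t'.reverse s'.reverse h1 (by simpa using h1'.reverse) h2 (fun x => by
    rw [← h2' x]; simp; tauto) h3 (by simpa using h3')

theorem IsVertexCycle.exists_long_arc {c : Cycle V} (hc : G.IsVertexCycle c) {a b : V}
    (ha : a ∈ c) (hb : b ∈ c) (hab : a ≠ b) :
    ∃ M : List V, (a :: (M ++ [b])).IsChain G.Adj ∧ (a :: (M ++ [b])).Nodup ∧ (∀ u ∈ M, u ∈ c) ∧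
      c.length ≤ 2 * M.length + 2 := by
  induction c using Quotient.inductionOn with
  | _ l =>
  simp only [Cycle.mk''_eq_coe, Cycle.mem_coe_iff] at ha hb hc ⊢
  obtain ⟨s, t, rfl⟩ := List.append_of_mem ha
  have hrot : (↑(s ++ a :: t) : Cycle V) = ↑(a :: (t ++ s)) := by
    rw [Cycle.coe_eq_coe]
    simpa using List.isRotated_append (l := s) (l' := a :: t)
  rw [hrot] at hc ⊢
  have hb' : b ∈ t ++ s := by simp at hb ⊢; tauto
  obtain ⟨p, q, hpq⟩ := List.append_of_mem hb'
  have hmem : ∀ u ∈ p ++ b :: q, u ∈ s ++ a :: t := by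
    intro u hu
    rw [← hpq] at hu
    simp at hu ⊢
    tauto
  rw [hpq] at hc ⊢
  obtain ⟨h1, h2, -⟩ := hc
  rw [Cycle.chain_coe_cons] at h1
  rw [Cycle.nodup_coe_iff] at h2
  rcases le_total q.length p.length with h | h
  · refine ⟨p, h1.infix ⟨[], q ++ [a], by simp⟩, h2.sublist ?_, fun u hu => hmem u (by simp [hu]), ?_⟩
    · exact List.Sublist.cons_cons _ (List.Sublist.append_left (by simp) _)
    · simp; omega
  · refine ⟨q.reverse, ?_, ?_, fun u hu => ?_, ?_⟩
    · have h3 : (b :: (q ++ [a])).IsChain G.Adj := h1.infix ⟨a :: p, [], by simp⟩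
      have h4 : (b :: (q ++ [a])).reverse.IsChain G.Adj := by
        rw [List.isChain_reverse]
        exact h3.imp fun _ _ h => h.symm
      simpa using h4
    · have : (a :: (q.reverse ++ [b])).Perm (a :: b :: q) := by
        refine List.Perm.cons _ ?_
        exact List.perm_append_comm.trans (List.Perm.cons _ (List.reverse_perm _))
      rw [this.nodup_iff]
      exact h2.sublist (List.Sublist.cons_cons _ (List.sublist_append_right _ _))
    · exact hmem u (by simp at hu; simp [hu])
    · simp; omega

theorem LongestVertexCycle.nontrivial_inter [Finite V]
    (hG : ∀ s : V, (G.induce {v | v ≠ s}).Preconnected) {c c' : Cycle V}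
    (hc : G.LongestVertexCycle c) (hc' : G.LongestVertexCycle c') :
    ({x | x ∈ c} ∩ {x | x ∈ c'}).Nontrivial := by
  by_contra hcon
  rw [Set.not_nontrivial_iff] at hcon
  have hnt : ∀ c, G.LongestVertexCycle c → {x | x ∈ c}.Nontrivial := by
    intro c hc
    have h3 := hc.1.2.2
    have hnd := hc.1.2.1
    induction c using Quotient.inductionOn with
    | _ l =>
    simp only [Cycle.mk''_eq_coe, Cycle.length_coe, Cycle.nodup_coe_iff] at h3 hnd
    match l, h3, hnd with
    | a :: b :: l, _, hnd =>
      refine ⟨a, by simp, b, by simp, ?_⟩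
      rintro rfl
      simp at hnd
  obtain ⟨P, Q, hP, hQ, hPQ, hw⟩ := exists_two_disjoint_isLink hG (hnt c hc) (hnt c' hc')
  replace hw := hw hcon
  obtain ⟨a, P₀, hPa, ha, hPa'⟩ := hP.start
  obtain ⟨P₁, a', hPb, ha', hPb'⟩ := hP.finish
  obtain ⟨b, Q₀, hQa, hb, hQa'⟩ := hQ.start
  obtain ⟨Q₁, b', hQb, hb', hQb'⟩ := hQ.finish
  simp only [Set.mem_ofPred_eq] at ha ha' hb hb' hPa' hPb' hQa' hQb'
  have hab : a ≠ b := by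
    rintro rfl
    exact hPQ (a := a) (by simp [hPa]) (by simp [hQa])
  have hab' : a' ≠ b' := by
    rintro rfl
    exact hPQ (a := a') (by simp [hPb]) (by simp [hQb])
  obtain ⟨M, hM1, hM2, hM3, hM4⟩ := hc.1.exists_long_arc hb ha hab.symm
  obtain ⟨M', hM1', hM2', hM3', hM4'⟩ := hc'.1.exists_long_arc ha' hb' hab'
  have hQr : Q.reverse = b' :: Q₁.reverse := by simp [hQb]
  have hQr' : Q.reverse = Q₀.reverse ++ [b] := by simp [hQa]
  have hlen := hc'.2 c hc.1
  have hlen' := hc.2 c' hc'.1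
  have hPQlen : 3 ≤ P.length + Q.length := by
    by_contra hlt
    have hP0 : P₀ = [] := by
      cases P₀ with
      | nil => rfl
      | cons _ _ => simp [hPa, hQa] at hlt; omega
    have hQ0 : Q₀ = [] := by
      cases Q₀ with
      | nil => rfl
      | cons _ _ => simp [hPa, hQa] at hlt; omega
    subst hP0 hQ0
    have haa : a ∈ c' := by
      rw [hPb] at hPa
      have : P₁ = [] ∧ a' = a := by simpa [List.append_eq_cons_iff] using hPa
      exact this.2 ▸ ha'
    have hbb : b ∈ c' := by
      rw [hQb] at hQa
      have : Q₁ = [] ∧ b' = b := by simpa [List.append_eq_cons_iff] using hQa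
      exact this.2 ▸ hb'
    exact hab (hcon ⟨ha, haa⟩ ⟨hb, hbb⟩)
  have hMP : ∀ u ∈ M, u ∉ P := by
    intro u hu huP
    rw [hPa] at huP
    rcases List.mem_cons.1 huP with rfl | huP
    · simp [List.nodup_append', hu] at hM2
    · exact hPa' u huP (hM3 u hu)
  have hMQ : ∀ u ∈ M, u ∉ Q := by
    intro u hu huP
    rw [hQa] at huP
    rcases List.mem_cons.1 huP with rfl | huP
    · simp [hu] at hM2
    · exact hQa' u huP (hM3 u hu)
  have hMP' : ∀ u ∈ M', u ∉ P := by
    intro u hu huP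
    rw [hPb] at huP
    rcases List.mem_append.1 huP with huP | huP
    · exact hPb' u huP (hM3' u hu)
    · rw [List.mem_singleton.1 huP] at hu
      simp [hu] at hM2'
  have hMQ' : ∀ u ∈ M', u ∉ Q := by
    intro u hu huP
    rw [hQb] at huP
    rcases List.mem_append.1 huP with huP | huP
    · exact hQb' u huP (hM3' u hu)
    · rw [List.mem_singleton.1 huP] at hu
      simp [List.nodup_append', hu] at hM2'
  have hMM' : ∀ u ∈ M, u ∉ M' := fun u hu hu' => hMP u hu (hw u ⟨hM3 u hu, hM3' u hu'⟩)
  have hMnd : M.Nodup :=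
    hM2.sublist ((List.sublist_append_left _ _).trans (List.sublist_cons_self _ _))
  have hMnd' : M'.Nodup :=
    hM2'.sublist ((List.sublist_append_left _ _).trans (List.sublist_cons_self _ _))
  have := hc.2 (↑(P ++ (M' ++ (Q.reverse ++ M))) : Cycle V) ⟨?_, ?_, ?_⟩
  · simp at this
    omega
  · have e : P ++ (M' ++ (Q.reverse ++ M)) = a :: (P₀ ++ (M' ++ (Q.reverse ++ M))) := by
      simp [hPa]
    have e' : a :: (P₀ ++ (M' ++ (Q.reverse ++ M)) ++ [a]) =
        P₁ ++ a' :: (M' ++ b' :: (Q₁.reverse ++ M ++ [a])) := by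
      calc _ = P ++ (M' ++ (Q.reverse ++ M)) ++ [a] := by rw [e]; simp
        _ = _ := by rw [hQr, hPb]; simp
    rw [e, Cycle.chain_coe_cons, e', List.isChain_append_interior]
    refine ⟨hPb ▸ hP.isChain, hM1', ?_⟩
    have e'' : b' :: (Q₁.reverse ++ M ++ [a]) = Q₀.reverse ++ b :: (M ++ [a]) := by
      calc _ = Q.reverse ++ M ++ [a] := by rw [hQr]; simp
        _ = _ := by rw [hQr']; simp
    rw [e'', List.isChain_split]
    refine ⟨?_, hM1⟩
    rw [← hQr', List.isChain_reverse]
    exact hQ.isChain.imp fun _ _ h => h.symm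
  · rw [Cycle.nodup_coe_iff, List.nodup_append', List.nodup_append', List.nodup_append']
    refine ⟨hP.nodup, ⟨hMnd', ⟨by simpa using hQ.nodup, hMnd, ?_⟩, ?_⟩, ?_⟩
    · intro u hu hu'
      exact hMQ u hu' (by simpa using hu)
    · intro u hu hu'
      rcases List.mem_append.1 hu' with hu' | hu'
      · exact hMQ' u hu (by simpa using hu')
      · exact hMM' u hu' hu
    · intro u hu hu'
      rcases List.mem_append.1 hu' with hu' | hu'
      · exact hMP' u hu' hu
      · rcases List.mem_append.1 hu' with hu' | hu'
        · exact hPQ hu (by simpa using hu')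
        · exact hMP u hu' hu
  · simp
    have := hc.1.2.2
    omega

end SimpleGraph

namespace SimpleGraph

variable {V : Type*} {W : Type*} {G : SimpleGraph V} [PartialOrder W] {S : V → Set W} {r : V → W}

theorem RootedRep.exists_child [Finite W] (R : RootedRep G S r) {t b : W} (htb : t < b) :
    ∃ h, t < h ∧ h ≤ b ∧ ∀ l : List V, l.IsChain G.Adj → (∀ u ∈ l, t ∉ S u) →
      (∃ u ∈ l, h ≤ r u) → ∀ w ∈ l, h ≤ r w := by
  obtain ⟨h, ⟨hth, hhb⟩, hmin⟩ := Set.Finite.exists_minimal (s := {a : W | t < a ∧ a ≤ b})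
    (Set.toFinite _) ⟨b, htb, le_rfl⟩
  refine ⟨h, hth, hhb, ?_⟩
  rintro l hl hS ⟨u, hu, hhu⟩
  have key : ∀ a ∈ l, ∀ b ∈ l, G.Adj a b → h ≤ r a → h ≤ r b := by
    intro a ha c hc hac h1
    by_contra h2
    have htc : t ≤ r c := by
      by_contra h3
      exact hS c hc (R.mem_of_adj hac (hth.le.trans h1) h3)
    have hlt : t < r c := lt_of_le_of_ne htc (by
      rintro rfl
      exact hS c hc (R.top_mem c))
    have h4 := R.top_le (R.mem_of_adj hac h1 h2)
    exact h2 (hmin ⟨hlt, h4.trans hhb⟩ h4)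
  exact hl.forall_of_mem (fun a ha b hb hab => ⟨key a ha b hb hab, key b hb a ha hab.symm⟩) hu hhu

theorem RootedRep.exists_node_nontrivial_vertexCycle [Finite V] [Finite W]
    (R : RootedRep G S r) {ρ : W} (hρ : ∀ a, ρ ≤ a)
    (hG : ∀ s : V, (G.induce {v | v ≠ s}).Preconnected) :
    ∃ t : W, ∀ c, G.LongestVertexCycle c → {x | x ∈ c ∧ t ∈ S x}.Nontrivial := by
  by_cases hex : ∃ c, G.LongestVertexCycle c
  swap
  · exact ⟨ρ, fun c hc => absurd ⟨c, hc⟩ hex⟩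
  obtain ⟨c₀, hc₀⟩ := hex
  have hp : ∃ c, G.LongestVertexCycle c ∧ ∃ z, ∀ u ∈ c, u = z ∨ ρ ≤ r u := by
    refine ⟨c₀, hc₀, ?_⟩
    obtain ⟨x, _⟩ := (hc₀.nontrivial_inter hG hc₀).nonempty
    exact ⟨x, fun u _ => Or.inr (hρ _)⟩
  obtain ⟨t, -, ⟨c', hc', z', hz'⟩, hmax⟩ := Finite.exists_le_maximal
    (p := fun t : W => ∃ c, G.LongestVertexCycle c ∧ ∃ z, ∀ u ∈ c, u = z ∨ t ≤ r u) hp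
  refine ⟨t, fun c hc => ?_⟩
  by_contra hnt
  rw [Set.not_nontrivial_iff] at hnt
  obtain ⟨z, hz, hzu⟩ : ∃ z ∈ c, ∀ x ∈ c, t ∈ S x → x = z := by
    by_cases h : ∃ z ∈ c, t ∈ S z
    · obtain ⟨z, hz, hzt⟩ := h
      exact ⟨z, hz, fun x hx hxt => hnt ⟨hx, hxt⟩ ⟨hz, hzt⟩⟩
    · push Not at h
      obtain ⟨x, hx, -⟩ := (hc.nontrivial_inter hG hc).nonempty
      exact ⟨x, hx, fun y hy hyt => absurd hyt (h y hy)⟩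
  obtain ⟨m, rfl⟩ : ∃ m : List V, c = ↑(z :: m) := by
    induction c using Quotient.inductionOn with
    | _ l =>
    simp only [Cycle.mk''_eq_coe, Cycle.mem_coe_iff] at hz ⊢
    obtain ⟨s, q, rfl⟩ := List.append_of_mem hz
    refine ⟨q ++ s, ?_⟩
    rw [Cycle.coe_eq_coe]
    simpa using List.isRotated_append (l := s) (l' := z :: q)
  have hch := hc.1.1
  have hnd := hc.1.2.1
  rw [Cycle.chain_coe_cons] at hch
  rw [Cycle.nodup_coe_iff, List.nodup_cons] at hnd
  have hmS : ∀ u ∈ m, t ∉ S u := by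
    intro u hu hut
    have := hzu u (by simp [hu]) hut
    exact hnd.1 (this ▸ hu)
  have hmch : m.IsChain G.Adj := hch.infix ⟨[z], [z], by simp⟩
  by_cases hm : ∃ u ∈ m, t ≤ r u
  · obtain ⟨u, hu, htu⟩ := hm
    obtain ⟨h, hth, hhu, hall⟩ := R.exists_child (lt_of_le_of_ne htu (by
      rintro rfl; exact hmS u hu (R.top_mem u)))
    have := hall m hmch hmS ⟨u, hu, hhu⟩
    refine hth.not_ge (hmax ⟨_, hc, z, fun w hw => ?_⟩ hth.le)
    rcases List.mem_cons.1 (Cycle.mem_coe_iff.1 hw) with h1 | h1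
    · exact Or.inl h1
    · exact Or.inr (this w h1)
  · push Not at hm
    obtain ⟨u, ⟨huc, huc'⟩, hne⟩ := (hc.nontrivial_inter hG hc').exists_ne z'
    have htu := (hz' u huc').resolve_left hne
    obtain rfl : u = z := by
      rcases List.mem_cons.1 (Cycle.mem_coe_iff.1 huc) with h1 | h1
      · exact h1
      · exact absurd htu (hm u h1)
    obtain ⟨w, m', rfl⟩ : ∃ w m', m = w :: m' := by
      cases m with
      | nil =>
        have := hc.1.2.2
        simp at this
      | cons w m' => exact ⟨w, m', rfl⟩
    have hadj : [u, w].IsChain G.Adj := hch.infix ⟨[], m' ++ [u], by simp⟩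
    exact hmS w (by simp) (R.mem_of_adj (u := u) (by simpa using hadj) htu (hm w (by simp)))

theorem RootedRep.exists_node_nontrivial_pathList [Finite V] [Nonempty V] [Finite W]
    (R : RootedRep G S r) {ρ : W} (hρ : ∀ a, ρ ≤ a) (hG : G.Preconnected) :
    ∃ (t : W) (A : Finset V), A.card ≤ 2 ∧ ∀ c, G.LongestPathList c → (∀ x ∈ A, x ∉ c) →
      {x | x ∈ c ∧ t ∈ S x}.Nontrivial := by
  classical
  have := Fintype.ofFinite V
  by_cases hex : ∃ c, G.LongestPathList c
  swap
  · exact ⟨ρ, ∅, by simp, fun c hc => absurd ⟨c, hc⟩ hex⟩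
  obtain ⟨c₀, hc₀⟩ := hex
  have hp : ∃ c, G.LongestPathList c ∧ ∃ z, ∀ u ∈ c, u = z ∨ ρ ≤ r u :=
    ⟨c₀, hc₀, Classical.arbitrary V, fun u _ => Or.inr (hρ _)⟩
  obtain ⟨t, -, ⟨c', hc', z', hz'⟩, hmax⟩ := Finite.exists_le_maximal
    (p := fun t : W => ∃ c, G.LongestPathList c ∧ ∃ z, ∀ u ∈ c, u = z ∨ t ≤ r u) hp
  replace hmax : ∀ h, t < h → ∀ c, G.LongestPathList c → ∀ z, ¬ ∀ u ∈ c, u = z ∨ h ≤ r u :=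
    fun h hth c hc z hz => hth.not_ge (hmax ⟨c, hc, z, hz⟩ hth.le)
  have hinter : ∀ c, G.LongestPathList c → z' ∉ c → ∃ u ∈ c, t ≤ r u := by
    intro c hc hzc
    obtain ⟨u, hu, hu'⟩ := hc.exists_mem_inter hG hc'
    refine ⟨u, hu, (hz' u hu').resolve_left ?_⟩
    rintro rfl
    exact hzc hu
  have hchild : ∀ {u}, t ≤ r u → t ∉ S u → t < r u := fun h1 h2 =>
    lt_of_le_of_ne h1 (fun h => h2 (h ▸ R.top_mem _))
  have hmeet : ∀ c, G.LongestPathList c → z' ∉ c → ∃ u ∈ c, t ∈ S u := by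
    intro c hc hzc
    by_contra hcon
    push Not at hcon
    obtain ⟨u, hu, htu⟩ := hinter c hc hzc
    obtain ⟨h, hth, hhu, hall⟩ := R.exists_child (hchild htu (hcon u hu))
    exact hmax h hth c hc z' fun w hw => Or.inr (hall c hc.1.1 hcon ⟨u, hu, hhu⟩ w hw)
  set 𝒯 : Set (List V × V × List V) := {p | G.LongestPathList (p.1 ++ p.2.1 :: p.2.2) ∧
    t ∈ S p.2.1 ∧ (∀ u ∈ p.1, t ∉ S u) ∧ (∀ u ∈ p.2.2, t ∉ S u) ∧ z' ∉ p.1 ++ p.2.1 :: p.2.2}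
  have hsingle : ∀ c, G.LongestPathList c → z' ∉ c → ¬ {x | x ∈ c ∧ t ∈ S x}.Nontrivial →
      ∃ X z Y, c = X ++ z :: Y ∧ (X, z, Y) ∈ 𝒯 := by
    intro c hc hzc hnt
    rw [Set.not_nontrivial_iff] at hnt
    obtain ⟨z, hz, hzt⟩ := hmeet c hc hzc
    obtain ⟨X, Y, rfl⟩ := List.append_of_mem hz
    have hnd := hc.1.2
    rw [List.nodup_append', List.nodup_cons] at hnd
    refine ⟨X, z, Y, rfl, hc, hzt, fun u hu hut => ?_, fun u hu hut => ?_, hzc⟩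
    · have : u = z := hnt ⟨by simp [hu], hut⟩ ⟨hz, hzt⟩
      exact hnd.2.2 (this ▸ hu) (by simp)
    · have : u = z := hnt ⟨by simp [hu], hut⟩ ⟨hz, hzt⟩
      exact hnd.2.1.1 (this ▸ hu)
  rcases 𝒯.eq_empty_or_nonempty with h𝒯 | h𝒯
  · refine ⟨t, {z'}, by simp, fun c hc hA => ?_⟩
    by_contra hnt
    obtain ⟨X, z, Y, -, h1⟩ := hsingle c hc (hA z' (by simp)) hnt
    rw [h𝒯] at h1
    exact h1
  obtain ⟨⟨X₁, z₁, Y₁⟩, ⟨hl, hz₁, hX₁, -, -⟩, hlong⟩ := Set.exists_forall_le_of_nat_bounded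
    (fun p : List V × V × List V => p.1.length) (N := Fintype.card V) (s := 𝒯) (by
      rintro p ⟨hp, _⟩
      have := hp.length_le
      simp at this
      omega) h𝒯
  simp only at hl hz₁ hX₁
  have hX₁z : (X₁ ++ [z₁]).IsChain G.Adj := hl.1.1.infix ⟨[], Y₁, by simp⟩
  refine ⟨t, {z', z₁}, Finset.card_le_two, fun c hc hA => ?_⟩
  by_contra hnt
  have hzc := hA z' (by simp)
  have hz₁c := hA z₁ (by simp)
  obtain ⟨X, z, Y, rfl, h𝒯'⟩ := hsingle c hc hzc hnt
  have hmeetX₁ : ∀ X Y, (X, z, Y) ∈ 𝒯 → z₁ ∉ X ++ z :: Y → ∃ w ∈ X₁, w ∈ Y := by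
    intro X Y hXY hz₁c
    have hlen : X.length ≤ X₁.length := hlong _ hXY
    obtain ⟨h1, h2, -, h4, -⟩ := hXY
    simp only at h1 h2 h4
    by_contra hcon
    push Not at hcon
    have hadj : G.Adj z₁ z := R.adj_of_mem hz₁ h2 (by rintro rfl; simp at hz₁c)
    have := h1.2 (X₁ ++ z₁ :: z :: Y) (by
      rw [List.isChain_append_cons_cons]
      exact ⟨hX₁z, hadj, h1.1.1.infix ⟨X, [], by simp⟩⟩) (by
      rw [List.nodup_append', List.nodup_cons]
      have hnd := hl.1.2
      rw [List.nodup_append'] at hnd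
      refine ⟨hnd.1, ⟨fun h => hz₁c (List.mem_append_right _ h),
        h1.1.2.sublist (List.sublist_append_right _ _)⟩, ?_⟩
      intro u hu hu'
      rcases List.mem_cons.1 hu' with rfl | hu'
      · exact hX₁ u hu hz₁
      · rcases List.mem_cons.1 hu' with rfl | hu'
        · exact hX₁ u hu h2
        · exact hcon u hu hu')
    simp at this
    omega
  obtain ⟨w, hw₁, hwY⟩ := hmeetX₁ X Y h𝒯' hz₁c
  have hrev : (Y.reverse, z, X.reverse) ∈ 𝒯 := by
    obtain ⟨h1, h2, h3, h4, h5⟩ := h𝒯'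
    refine ⟨by simpa using h1.reverse, h2, by simpa using h4, by simpa using h3, ?_⟩
    intro h
    apply h5
    simp at h ⊢
    tauto
  obtain ⟨w', hw₁', hwX⟩ := hmeetX₁ Y.reverse X.reverse hrev (by
    intro h
    apply hz₁c
    simp at h ⊢
    tauto)
  rw [List.mem_reverse] at hwX
  obtain ⟨-, hzt, hXS, hYS, -⟩ := h𝒯'
  simp only at hzt hXS hYS
  have hXch : X.IsChain G.Adj := hc.1.1.infix ⟨[], z :: Y, by simp⟩
  have hYch : Y.IsChain G.Adj := hc.1.1.infix ⟨X ++ [z], [], by simp⟩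
  have hX₁ch : X₁.IsChain G.Adj := hl.1.1.infix ⟨[], z₁ :: Y₁, by simp⟩
  by_cases htw : t ≤ r w
  · obtain ⟨h, hth, hhw, hall⟩ := R.exists_child (hchild htw (hYS w hwY))
    have hX₁h := hall X₁ hX₁ch hX₁ ⟨w, hw₁, hhw⟩
    have hYh := hall Y hYch hYS ⟨w, hwY, hhw⟩
    have hXh := hall X hXch hXS ⟨w', hwX, hX₁h w' hw₁'⟩
    refine hmax h hth _ hc z fun u hu => ?_
    rcases List.mem_append.1 hu with hu | hu
    · exact Or.inr (hXh u hu)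
    · rcases List.mem_cons.1 hu with hu | hu
      · exact Or.inl hu
      · exact Or.inr (hYh u hu)
  · have hX₁t : ∀ u ∈ X₁, ¬ t ≤ r u := fun u hu h =>
      htw (R.le_top_of_isChain hX₁ch hX₁ hu h w hw₁)
    have hYt : ∀ u ∈ Y, ¬ t ≤ r u := fun u hu h =>
      htw (R.le_top_of_isChain hYch hYS hu h w hwY)
    have hXt : ∀ u ∈ X, ¬ t ≤ r u := fun u hu h =>
      hX₁t w' hw₁' (R.le_top_of_isChain hXch hXS hu h w' hwX)
    obtain ⟨u, hu, htu⟩ := hinter _ hc hzc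
    obtain rfl : u = z := by
      rcases List.mem_append.1 hu with hu | hu
      · exact absurd htu (hXt u hu)
      · rcases List.mem_cons.1 hu with hu | hu
        · exact hu
        · exact absurd htu (hYt u hu)
    cases Y with
    | nil => simp at hwY
    | cons y Y =>
      have hadj : [u, y].IsChain G.Adj := hc.1.1.infix ⟨X, Y, by simp⟩
      exact hYS y (by simp) (R.mem_of_adj (u := u) (by simpa using hadj) htu (hYt y (by simp)))

end SimpleGraph

namespace SimpleGraph

variable {V : Type*} {W : Type*} {G : SimpleGraph V} {T : SimpleGraph W}

/-- The node `a` separates `b` from the root `t`. -/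
def Ancestor (T : SimpleGraph W) (t a b : W) : Prop := ∀ p : T.Walk t b, a ∈ p.support

theorem IsTree.ancestor_of_mem_support (hT : T.IsTree) {t a b : W} {p : T.Walk t b}
    (hp : p.IsPath) (ha : a ∈ p.support) : T.Ancestor t a b := by
  classical
  intro q
  have := congrArg Subtype.val ((hT.isAcyclic.subsingleton_path t b).elim ⟨p, hp⟩
    ⟨q.bypass, q.bypass_isPath⟩)
  simp only at this
  rw [this] at ha
  exact q.support_bypass_subset_support ha

theorem Ancestor.trans {t a b c : W} (h : T.Ancestor t a b) (h' : T.Ancestor t b c) :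
    T.Ancestor t a c := by
  classical
  intro p
  exact p.support_takeUntil_subset_support (h' p) (h _)

theorem IsTree.ancestor_antisymm (hT : T.IsTree) {t a b : W} (h : T.Ancestor t a b)
    (h' : T.Ancestor t b a) : a = b := by
  classical
  by_contra hne
  obtain ⟨p, hp⟩ := hT.connected.exists_isPath t b
  exact Walk.endpoint_notMem_support_takeUntil hp (h p) (Ne.symm hne) (h' _)

theorem IsTree.ancestor_comparable (hT : T.IsTree) {t a b c : W} (h : T.Ancestor t a c)
    (h' : T.Ancestor t b c) : T.Ancestor t a b ∨ T.Ancestor t b a := by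
  classical
  obtain ⟨p, hp⟩ := hT.connected.exists_isPath t c
  have ha := h p
  have hb := h' p
  rw [← p.take_spec ha, Walk.mem_support_append_iff] at hb
  rcases hb with hb | hb
  · exact Or.inr (hT.ancestor_of_mem_support (hp.takeUntil ha) hb)
  · refine Or.inl (hT.ancestor_of_mem_support
      (p := (p.takeUntil a ha).append ((p.dropUntil a ha).takeUntil b hb)) ?_ ?_)
    · refine Walk.IsPath.of_append_left (q := (p.dropUntil a ha).dropUntil b hb) ?_
      rw [← Walk.append_assoc, Walk.take_spec, Walk.take_spec]
      exact hp
    · rw [Walk.mem_support_append_iff]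
      exact Or.inl (Walk.end_mem_support _)

/-- The ancestor order of a tree rooted at `t`. -/
@[reducible] def IsTree.ancestorOrder (hT : T.IsTree) (t : W) : PartialOrder W where
  le a b := T.Ancestor t a b
  le_refl _ p := p.end_mem_support
  le_trans _ _ _ h h' := h.trans h'
  le_antisymm _ _ h h' := hT.ancestor_antisymm h h'

theorem IsTree.exists_top [Finite W] (hT : T.IsTree) (t : W) {C : Set W}
    (hC : (T.induce C).Connected) : ∃ r ∈ C, (∀ b ∈ C, T.Ancestor t r b) ∧
      ∀ a b, b ∈ C → T.Ancestor t r a → T.Ancestor t a b → a ∈ C := by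
  classical
  let _ := hT.ancestorOrder t
  obtain ⟨⟨x₀, hx₀⟩⟩ := hC.nonempty
  obtain ⟨x, hx, hmin⟩ := Set.Finite.exists_minimal (s := C) (Set.toFinite _) ⟨x₀, hx₀⟩
  obtain ⟨q, hq⟩ := hT.connected.exists_isPath t x
  have hqC : ∀ z ∈ q.support, z ∈ C → z = x := fun z hz hzC => by
    have h1 : T.Ancestor t z x := hT.ancestor_of_mem_support hq hz
    exact hT.ancestor_antisymm h1 (hmin hzC h1)
  have hpath : ∀ y ∈ C, ∃ w : T.Walk x y, (∀ z ∈ w.support, z ∈ C) ∧ (q.append w).IsPath := by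
    intro y hy
    obtain ⟨w, hwp, hwC⟩ : ∃ w : T.Walk x y, w.IsPath ∧ ∀ z ∈ w.support, z ∈ C := by
      obtain ⟨w, hw⟩ := hC.exists_isPath ⟨x, hx⟩ ⟨y, hy⟩
      refine ⟨w.map (Embedding.induce (G := T) C).toHom,
        hw.map (Embedding.induce (G := T) C).injective, ?_⟩
      intro z hz
      have e := Walk.support_map (Embedding.induce (G := T) C).toHom w
      have hz' : z ∈ List.map (Embedding.induce (G := T) C).toHom w.support := e ▸ hz
      obtain ⟨u, _, rfl⟩ := List.mem_map.1 hz'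
      exact u.2
    refine ⟨w, hwC, ?_⟩
    rw [Walk.isPath_def] at hwp ⊢
    rw [← Walk.cons_tail_support, List.nodup_cons] at hwp
    rw [Walk.support_append, List.nodup_append']
    refine ⟨hq.support_nodup, hwp.2, ?_⟩
    intro z hz hz'
    have := hqC z hz (hwC z (List.mem_of_mem_tail hz'))
    exact hwp.1 (this ▸ hz')
  refine ⟨x, hx, ?_, ?_⟩
  · intro b hb
    obtain ⟨w, -, hw⟩ := hpath b hb
    exact hT.ancestor_of_mem_support hw ((Walk.mem_support_append_iff _ _).2
      (Or.inl (Walk.end_mem_support _)))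
  · intro a b hb hxa hab
    obtain ⟨w, hwC, -⟩ := hpath b hb
    rcases (Walk.mem_support_append_iff _ _).1 (hab (q.append w)) with h | h
    · have h1 : T.Ancestor t a x := hT.ancestor_of_mem_support hq h
      rw [hT.ancestor_antisymm h1 hxa]
      exact hx
    · exact hwC a h

theorem IsTree.leavesAbove_le [Finite W] (hT : T.IsTree) (t : W) :
    @leavesAbove W (hT.ancestorOrder t) t ≤ max 1 T.numLeaves := by
  classical
  let _ := hT.ancestorOrder t
  have hbot : ∀ a, t ≤ a := fun a p => p.start_mem_support
  by_cases ht : IsMax t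
  · refine le_max_of_le_left ?_
    unfold leavesAbove
    rw [Set.ncard_le_one_iff]
    rintro a b ⟨-, _⟩ ⟨-, _⟩
    rw [← ht.eq_of_le (hbot a), ← ht.eq_of_le (hbot b)]
  · refine le_max_of_le_right (Set.ncard_le_ncard ?_ (Set.toFinite _))
    rintro b ⟨hb, -⟩
    have hbt : b ≠ t := by rintro rfl; exact ht hb
    obtain ⟨p, hp⟩ := hT.connected.exists_isPath t b
    have hnil : ¬ p.Nil := fun h => hbt h.eq.symm
    refine Set.ncard_eq_one.2 ⟨p.penultimate, ?_⟩
    ext d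
    simp only [mem_neighborSet, Set.mem_singleton_iff]
    constructor
    · intro hd
      by_cases hdp : d ∈ p.support
      · exact hT.isAcyclic.eq_penultimate_of_adj_end hp hd hdp
      · have hbd : b ≤ d := hT.ancestor_of_mem_support (hp.concat hdp hd) (by
          rw [Walk.support_concat]
          simp)
        exact absurd (hb.eq_of_le hbd) hd.ne
    · rintro rfl
      exact (Walk.adj_penultimate hnil).symm

theorem IsTreeRepresentation.exists_rootedRep [Finite W] {S : V → Set W}
    (h : G.IsTreeRepresentation T S) (t : W) : ∃ (_ : PartialOrder W) (r : V → W),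
      G.RootedRep S r ∧ (∀ a, t ≤ a) ∧ leavesAbove t ≤ max 1 T.numLeaves := by
  choose r hr hr' hr'' using fun v => h.isTree.exists_top t (h.subtree_connected v)
  let _ := h.isTree.ancestorOrder t
  exact ⟨h.isTree.ancestorOrder t, r, ⟨fun h1 h2 => h.isTree.ancestor_comparable h1 h2, hr,
    fun {u b} hb => hr' u b hb, fun {u a b} hb h1 h2 => hr'' u a b hb h1 h2,
    fun {u w} huw => h.adj_iff u w huw⟩, fun a p => p.start_mem_support,
    h.isTree.leavesAbove_le t⟩

/-- The Helly property of subtrees of a tree. -/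
theorem IsTree.exists_mem_of_pairwise_inter [Finite W] (hT : T.IsTree) {ι : Type*} [Finite ι]
    {C : ι → Set W} (hC : ∀ i, (T.induce (C i)).Connected)
    (hpair : ∀ i j, (C i ∩ C j).Nonempty) : ∃ t, ∀ i, t ∈ C i := by
  obtain ⟨ρ⟩ := hT.connected.nonempty
  choose r hr hr' hr'' using fun i => hT.exists_top ρ (hC i)
  let _ := hT.ancestorOrder ρ
  cases isEmpty_or_nonempty ι with
  | inl _ => exact ⟨ρ, fun i => isEmptyElim i⟩
  | inr hne =>
    obtain ⟨i, -, hi⟩ := Set.Finite.exists_maximalFor r (Set.univ : Set ι) (Set.toFinite _)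
      Set.univ_nonempty
    refine ⟨r i, fun j => ?_⟩
    obtain ⟨a, hai, haj⟩ := hpair i j
    have hji : T.Ancestor ρ (r j) (r i) := by
      rcases hT.ancestor_comparable (hr' i a hai) (hr' j a haj) with h | h
      · exact hi (Set.mem_univ j) h
      · exact h
    exact hr'' j (r i) a haj hji (hr' i a hai)

end SimpleGraph

namespace SimpleGraph

variable {V : Type*} {G : SimpleGraph V}

theorem exists_walk_support_eq {L : List V} (hL : L.IsChain G.Adj) (hne : L ≠ []) {x y : V}
    (hx : L.head hne = x) (hy : L.getLast hne = y) : ∃ p : G.Walk x y, p.support = L := by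
  subst hx hy
  exact ⟨Walk.ofSupport L hne hL, Walk.support_ofSupport _ _⟩

theorem exists_isCycle_of_isChain {a : V} {m : List V} (hch : (a :: (m ++ [a])).IsChain G.Adj)
    (hnd : (a :: m).Nodup) (hm : 2 ≤ m.length) :
    ∃ c : G.Walk a a, c.IsCycle ∧ c.support = a :: (m ++ [a]) := by
  obtain ⟨b, d, m, rfl⟩ : ∃ b d m', m = b :: d :: m' := by
    match m with
    | b :: d :: m' => exact ⟨b, d, m', rfl⟩
  rw [List.cons_append, List.isChain_cons_cons] at hch
  obtain ⟨p, hp⟩ : ∃ p : G.Walk b a, p.support = b :: (d :: m ++ [a]) := by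
    exact exists_walk_support_eq hch.2 (by simp) (by simp) (by simp)
  have hnd' : (b :: (d :: m ++ [a])).Nodup := by
    have : (b :: (d :: m ++ [a])).Perm (a :: b :: d :: m) := by
      rw [← List.cons_append]
      exact List.perm_append_comm.trans (by simp)
    exact this.nodup_iff.2 hnd
  refine ⟨Walk.cons hch.1 p, ?_, by simp [hp]⟩
  rw [Walk.cons_isCycle_iff, Walk.isPath_def, hp]
  refine ⟨hnd', fun hmem => ?_⟩
  rw [← Walk.infix_support_iff_mem_edges, hp] at hmem
  have hb : b ∉ d :: m ++ [a] := (List.nodup_cons.1 hnd').1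
  have ha : a ∉ b :: d :: m := (List.nodup_cons.1 hnd).1
  rcases hmem with ⟨s, t, hst⟩ | ⟨s, t, hst⟩
  · cases s with
    | nil =>
      simp at hst
      exact ha (by simp [hst.1])
    | cons e s =>
      simp only [List.cons_append, List.cons.injEq] at hst
      exact hb (by rw [List.cons_append, ← hst.2]; simp)
  · cases s with
    | nil =>
      simp at hst
      exact ha (by simp [hst.1])
    | cons e s =>
      simp only [List.cons_append, List.cons.injEq] at hst
      exact hb (by rw [List.cons_append, ← hst.2]; simp)

theorem Walk.IsCycle.exists_isVertexCycle {v : V} {c : G.Walk v v} (hc : c.IsCycle) :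
    ∃ m : List V, c.support = v :: (m ++ [v]) ∧ G.IsVertexCycle (↑(v :: m) : Cycle V) ∧
      m.length + 1 = c.length := by
  obtain ⟨m, hm⟩ : ∃ m, c.support = v :: (m ++ [v]) := by
    refine ⟨c.support.tail.dropLast, ?_⟩
    have hne : c.support.tail ≠ [] := by
      intro h
      have h1 := congrArg List.length h
      have h2 := hc.three_le_length
      rw [List.length_tail, Walk.length_support, List.length_nil] at h1
      omega
    have h1 : c.support.tail.getLast hne = v := by
      rw [List.getLast_tail]
      exact c.getLast_support
    conv_lhs => rw [← c.cons_tail_support, ← List.dropLast_append_getLast hne, h1]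
  have hlen : m.length + 1 = c.length := by
    have := c.length_support
    rw [hm] at this
    simp at this
    omega
  refine ⟨m, hm, ⟨?_, ?_, ?_⟩, hlen⟩
  · rw [Cycle.chain_coe_cons, ← hm]
    exact c.isChain_adj_support
  · rw [Cycle.nodup_coe_iff]
    have := hc.support_nodup
    rw [hm, List.tail_cons] at this
    have hp : (v :: m).Perm (m ++ [v]) := (List.perm_append_singleton v m).symm
    exact hp.nodup_iff.2 this
  · have := hc.three_le_length
    simp
    omega

theorem IsLink.adj_consecutive {U X Y : Set V} {l : List V} (hl : G.IsLink X Y l)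
    (hU : ∀ u ∈ l, u ∈ U)
    (hmin : ∀ l', G.IsLink X Y l' → (∀ u ∈ l', u ∈ U) → l.length ≤ l'.length) {p q t : List V}
    {a b : V} (h : l = p ++ a :: (q ++ b :: t)) (hab : G.Adj a b) : q = [] := by
  have hch := hl.isChain
  rw [h] at hch
  have hsub : ∀ u ∈ p ++ a :: b :: t, u ∈ l := by
    intro u hu
    rw [h]
    simp at hu ⊢
    tauto
  have := hmin (p ++ a :: b :: t) ⟨?_, ?_, ?_, ?_⟩ fun u hu => hU u (hsub u hu)
  · rw [h] at this
    simp only [List.length_append, List.length_cons] at this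
    exact List.length_eq_zero_iff.1 (by omega)
  · rw [List.isChain_append_cons_cons]
    exact ⟨hch.infix ⟨[], q ++ b :: t, by simp⟩, hab, hch.infix ⟨p ++ a :: q, [], by simp⟩⟩
  · have := hl.nodup
    rw [h] at this
    refine this.sublist (List.Sublist.append_left (List.Sublist.cons_cons _ ?_) _)
    exact List.sublist_append_right _ _
  · obtain ⟨x, m, hm, hx, hmx⟩ := hl.start
    rw [h] at hm
    cases p with
    | nil =>
      simp only [List.nil_append, List.cons.injEq] at hm
      refine ⟨x, b :: t, by simp [hm.1], hx, fun u hu => hmx u ?_⟩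
      rw [← hm.2]
      exact List.mem_append_right _ hu
    | cons c p =>
      simp only [List.cons_append, List.cons.injEq] at hm
      refine ⟨x, p ++ a :: b :: t, by simp [hm.1], hx, fun u hu => hmx u ?_⟩
      rw [← hm.2]
      simp at hu ⊢
      tauto
  · obtain ⟨m, y, hm, hy, hmy⟩ := hl.finish
    rw [h] at hm
    rcases List.eq_nil_or_concat t with rfl | ⟨t, d, rfl⟩
    · have h1 : (p ++ a :: q) ++ [b] = m ++ [y] := by simpa using hm
      obtain ⟨h2, h3⟩ := List.append_inj' h1 rfl
      refine ⟨p ++ [a], y, ?_, hy, fun u hu => hmy u ?_⟩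
      · rw [← h3]; simp
      · rw [← h2]
        simp at hu ⊢
        tauto
    · have h1 : (p ++ a :: (q ++ b :: t)) ++ [d] = m ++ [y] := by simpa using hm
      obtain ⟨h2, h3⟩ := List.append_inj' h1 rfl
      refine ⟨p ++ a :: b :: t, y, ?_, hy, fun u hu => hmy u ?_⟩
      · rw [← h3]; simp
      · rw [← h2]
        simp at hu ⊢
        tauto

/-- In a chordal graph, two neighbours of `u` that attach to a connected set avoiding the
neighbourhood of `u` are adjacent. -/
theorem IsChordalGraph.adj_of_attached (hG : G.IsChordalGraph) {u s s' : V} {H : Set V}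
    (hH : (G.induce H).Preconnected) (huH : ∀ x ∈ H, x ≠ u ∧ ¬ G.Adj u x) (hus : G.Adj u s)
    (hus' : G.Adj u s') (hs : ∃ x ∈ H, G.Adj s x) (hs' : ∃ x ∈ H, G.Adj s' x) (hne : s ≠ s') :
    G.Adj s s' := by
  by_contra hnadj
  obtain ⟨x, hx, hsx⟩ := hs
  obtain ⟨x', hx', hsx'⟩ := hs'
  obtain ⟨l, hl, hlH, hmin⟩ := exists_shortest_isLink hH (X := {x | G.Adj s x})
    (Y := {x | G.Adj s' x}) hsx hx hsx' hx'
  obtain ⟨a, m, hlm, ha, hma⟩ := hl.start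
  obtain ⟨m', b, hlm', hb, hmb⟩ := hl.finish
  simp only [Set.mem_ofPred_eq] at ha hma hb hmb
  have hsl : s ∉ l := fun h => (huH s (hlH s h)).2 hus
  have hsl' : s' ∉ l := fun h => (huH s' (hlH s' h)).2 hus'
  have hul : u ∉ l := fun h => (huH u (hlH u h)).1 rfl
  obtain ⟨c, hc, hsupp⟩ := exists_isCycle_of_isChain (G := G) (a := u) (m := s :: (l ++ [s']))
    (by
      have h1 : (s :: (l ++ [s'])).IsChain G.Adj := by
        rw [← List.cons_append, List.isChain_append]
        refine ⟨?_, by simp, ?_⟩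
        · rw [hlm, List.isChain_cons_cons, ← hlm]
          exact ⟨ha, hl.isChain⟩
        · intro y hy z hz
          rw [hlm', ← List.cons_append] at hy
          simp only [List.getLast?_append, List.getLast?_singleton, Option.some_or,
            Option.mem_def, Option.some.injEq, List.head?_cons] at hy hz
          subst hy hz
          exact hb.symm
      rw [List.cons_append, List.isChain_cons_cons, ← List.cons_append, List.isChain_append]
      refine ⟨hus, h1, by simp, ?_⟩
      intro y hy z hz
      rw [← List.cons_append] at hy
      simp only [List.getLast?_append, List.getLast?_singleton, Option.some_or, Option.mem_def,
        Option.some.injEq, List.head?_cons] at hy hz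
      subst hy hz
      exact hus'.symm)
    (by
      simp only [List.nodup_cons, List.mem_cons, List.mem_append, List.not_mem_nil, or_false,
        not_or, List.nodup_append', List.disjoint_singleton, List.not_mem_nil,
        not_false_eq_true, List.nodup_nil, and_true]
      exact ⟨⟨hus.ne, hul, hus'.ne⟩, ⟨hsl, hne⟩, hl.nodup, trivial, hsl'⟩)
    (by simp)
  have hlen : 4 ≤ c.length := by
    have := c.length_support
    rw [hsupp, hlm] at this
    simp at this
    omega
  obtain ⟨y, hy, z, hz, hyz, hnot⟩ := hG u c hc hlen
  apply hnot
  rw [← Walk.infix_support_iff_mem_edges, hsupp]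
  rw [hsupp] at hy hz
  set L := u :: (s :: (l ++ [s']) ++ [u]) with hL
  let E : V → V → Prop := fun y z => [y, z] <:+: L ∨ [z, y] <:+: L
  have hmemL : ∀ y ∈ L, y = u ∨ y = s ∨ y ∈ l ∨ y = s' := by
    intro y hy
    simp [hL] at hy
    tauto
  have hEs : ∀ {y z}, E y z → E z y := fun h => h.symm
  have hEu : ∀ z ∈ L, G.Adj u z → E u z := by
    intro z hz huz
    rcases hmemL z hz with rfl | rfl | hz | rfl
    · exact absurd huz (G.irrefl)
    · exact Or.inl ⟨[], l ++ [s'] ++ [u], by simp [hL]⟩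
    · exact absurd huz (huH z (hlH z hz)).2
    · exact Or.inr ⟨u :: s :: l, [], by simp [hL]⟩
  have hEs1 : ∀ z ∈ L, G.Adj s z → E s z := by
    intro z hz hsz
    rcases hmemL z hz with rfl | rfl | hz | rfl
    · exact hEs (hEu s (by simp [hL]) hsz.symm)
    · exact absurd hsz (G.irrefl)
    · rw [hlm] at hz
      rcases List.mem_cons.1 hz with rfl | hz
      · exact Or.inl ⟨[u], m ++ [s'] ++ [u], by simp [hL, hlm]⟩
      · exact absurd hsz (hma z hz)
    · exact absurd hsz hnadj
  have hEs2 : ∀ z ∈ L, G.Adj s' z → E s' z := by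
    intro z hz hsz
    rcases hmemL z hz with rfl | rfl | hz | rfl
    · exact hEs (hEu s' (by simp [hL]) hsz.symm)
    · exact absurd hsz.symm hnadj
    · rw [hlm'] at hz
      rcases List.mem_append.1 hz with hz | hz
      · exact absurd hsz (hmb z hz)
      · rw [List.mem_singleton.1 hz]
        exact Or.inr ⟨u :: s :: m', [u], by simp [hL, hlm']⟩
    · exact absurd hsz (G.irrefl)
  change E y z
  rcases hmemL y hy with rfl | rfl | hyl | rfl
  · exact hEu z hz hyz
  · exact hEs1 z hz hyz
  · rcases hmemL z hz with rfl | rfl | hzl | rfl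
    · exact hEs (hEu y hy hyz.symm)
    · exact hEs (hEs1 y hy hyz.symm)
    · obtain ⟨p, t, hpt⟩ := List.append_of_mem hyl
      have hz' : z ∈ p ∨ z ∈ t := by
        rw [hpt] at hzl
        simp at hzl
        rcases hzl with h | h | h
        · exact Or.inl h
        · exact absurd h hyz.ne.symm
        · exact Or.inr h
      rcases hz' with hz' | hz'
      · obtain ⟨p, q, rfl⟩ := List.append_of_mem hz'
        have hq := hl.adj_consecutive hlH hmin (p := p) (q := q) (t := t) (by rw [hpt]; simp)
          hyz.symm
        subst hq
        exact Or.inr ⟨u :: s :: p, t ++ [s'] ++ [u], by simp [hL, hpt]⟩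
      · obtain ⟨q, t, rfl⟩ := List.append_of_mem hz'
        have hq := hl.adj_consecutive hlH hmin hpt hyz
        subst hq
        exact Or.inl ⟨u :: s :: p, t ++ [s'] ++ [u], by simp [hL, hpt]⟩
    · exact hEs (hEs2 y hy hyz.symm)
  · exact hEs2 z hz hyz

/-- Dirac's theorem, with the simplicial vertex outside the neighbourhood of a given vertex. -/
theorem IsChordalGraph.exists_simplicial_of_not_adj [Finite V] (hG : G.IsChordalGraph) (n : ℕ) :
    ∀ X : Set V, X.ncard = n → ∀ u ∈ X, (∃ w ∈ X, w ≠ u ∧ ¬ G.Adj u w) →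
      ∃ x ∈ X, x ≠ u ∧ ¬ G.Adj u x ∧ G.IsClique {y ∈ X | G.Adj x y} := by
  induction n using Nat.strong_induction_on with
  | _ n ih =>
  rintro X hn u hu ⟨w, hw, hwu⟩
  obtain ⟨H, ⟨⟨hwH, hHN, hHconn⟩, hmax⟩⟩ := Set.Finite.exists_maximal
    (s := {H : Set V | w ∈ H ∧ (∀ x ∈ H, x ∈ X ∧ x ≠ u ∧ ¬ G.Adj u x) ∧
      (G.induce H).Preconnected}) (Set.toFinite _) ⟨{w}, rfl, by
        rintro x rfl
        exact ⟨hw, hwu⟩, by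
        rintro ⟨a, rfl⟩ ⟨b, rfl⟩
        exact Reachable.refl _⟩
  have hclosed : ∀ x ∈ H, ∀ y ∈ X, y ≠ u → ¬ G.Adj u y → G.Adj x y → y ∈ H := by
    intro x hx y hy hyu huy hxy
    refine hmax (y := H ∪ {x, y}) ⟨Or.inl hwH, ?_, ?_⟩ Set.subset_union_left
      (Or.inr (by simp))
    · rintro z (hz | rfl | rfl)
      · exact hHN z hz
      · exact hHN z hx
      · exact ⟨hy, hyu, huy⟩
    · exact (induce_union_connected hHconn
        (induce_pair_connected_of_adj hxy).preconnected ⟨x, hx, by simp⟩).preconnected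
  set B : Set V := {s ∈ X | G.Adj u s ∧ ∃ x ∈ H, G.Adj s x} with hB
  have hBclique : ∀ s ∈ B, ∀ s' ∈ B, s ≠ s' → G.Adj s s' := fun s hs s' hs' hne =>
    hG.adj_of_attached hHconn (fun x hx => (hHN x hx).2) hs.2.1 hs'.2.1 hs.2.2 hs'.2.2 hne
  have hsub : H ∪ B ⊆ X := by
    rintro x (hx | hx)
    · exact (hHN x hx).1
    · exact hx.1
  have huHB : u ∉ H ∪ B := by
    rintro (h | h)
    · exact (hHN u h).2.1 rfl
    · exact G.irrefl h.2.1
  have hlt : (H ∪ B).ncard < n := by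
    rw [← hn]
    exact Set.ncard_lt_ncard ((Set.ssubset_iff_of_subset hsub).2 ⟨u, hu, huHB⟩) (Set.toFinite _)
  obtain ⟨x, hxH, hx⟩ : ∃ x ∈ H, G.IsClique {y ∈ H ∪ B | G.Adj x y} := by
    by_cases h1 : ∃ s ∈ B, ∃ w ∈ H ∪ B, w ≠ s ∧ ¬ G.Adj s w
    · obtain ⟨s, hs, hs'⟩ := h1
      obtain ⟨x, hx, hxs, hsx, hclique⟩ := ih _ hlt (H ∪ B) rfl s (Or.inr hs) hs'
      exact ⟨x, hx.resolve_right fun h => hsx (hBclique s hs x h hxs.symm), hclique⟩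
    push Not at h1
    by_cases h2 : ∃ a ∈ H, ∃ w ∈ H ∪ B, w ≠ a ∧ ¬ G.Adj a w
    · obtain ⟨a, ha, ha'⟩ := h2
      obtain ⟨x, hx, hxa, hax, hclique⟩ := ih _ hlt (H ∪ B) rfl a (Or.inl ha) ha'
      exact ⟨x, hx.resolve_right fun h => hax (h1 x h a (Or.inl ha) hxa.symm).symm, hclique⟩
    · push Not at h2
      refine ⟨w, hwH, ?_⟩
      rintro a ⟨ha, -⟩ b ⟨hb, -⟩ hab
      rcases ha with ha | ha
      · exact h2 a ha b hb hab.symm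
      · exact h1 a ha b hb hab.symm
  refine ⟨x, (hHN x hxH).1, (hHN x hxH).2.1, (hHN x hxH).2.2, ?_⟩
  have hmem : ∀ y ∈ X, G.Adj x y → y ∈ H ∪ B := by
    intro y hy hxy
    by_cases huy : G.Adj u y
    · exact Or.inr ⟨hy, huy, x, hxH, hxy.symm⟩
    · refine Or.inl (hclosed x hxH y hy ?_ huy hxy)
      rintro rfl
      exact (hHN x hxH).2.2 hxy.symm
  rintro a ⟨ha, hxa⟩ b ⟨hb, hxb⟩ hab
  exact hx ⟨hmem a ha hxa, hxa⟩ ⟨hmem b hb hxb, hxb⟩ hab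

theorem IsChordalGraph.exists_simplicial [Finite V] (hG : G.IsChordalGraph) {X : Set V}
    (hX : X.Nonempty) : ∃ x ∈ X, G.IsClique {y ∈ X | G.Adj x y} := by
  by_cases h : ∃ u ∈ X, ∃ w ∈ X, w ≠ u ∧ ¬ G.Adj u w
  · obtain ⟨u, hu, hw⟩ := h
    obtain ⟨x, hx, -, -, hx'⟩ := hG.exists_simplicial_of_not_adj _ X rfl u hu hw
    exact ⟨x, hx, hx'⟩
  · push Not at h
    obtain ⟨x, hx⟩ := hX
    exact ⟨x, hx, fun a ha b hb hab => h a ha.1 b hb.1 hab.symm⟩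

end SimpleGraph

namespace SimpleGraph

variable {V : Type*} {G : SimpleGraph V}

theorem Connected.induce_image {W W' : Type*} {T : SimpleGraph W} {T' : SimpleGraph W'}
    (f : T →g T') {C : Set W} (hC : (T.induce C).Connected) : (T'.induce (f '' C)).Connected :=
  hC.map (G := T.induce C) (H := T'.induce (f '' C))
    ⟨fun x => ⟨f x, x, x.2, rfl⟩, fun {a b} h => f.map_adj (v := a.1) (w := b.1) h⟩
    (by
      rintro ⟨_, x, hx, rfl⟩
      exact ⟨⟨x, hx⟩, rfl⟩)

/-- The tree `T` with a new vertex attached to `t`. -/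
def attachLeaf {n : ℕ} (T : SimpleGraph (Fin n)) (t : Fin n) : SimpleGraph (Fin (n + 1)) :=
  T.map Fin.castSuccEmb ⊔ edge t.castSucc (Fin.last n)

theorem attachLeaf_adj_last {n : ℕ} (T : SimpleGraph (Fin n)) (t : Fin n) :
    (T.attachLeaf t).Adj t.castSucc (Fin.last n) :=
  Or.inr ((edge_adj _ _ _ _).2 ⟨Or.inl ⟨rfl, rfl⟩, (Fin.castSucc_lt_last t).ne⟩)

def attachLeafHom {n : ℕ} (T : SimpleGraph (Fin n)) (t : Fin n) : T →g T.attachLeaf t where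
  toFun := Fin.castSucc
  map_rel' h := Or.inl ((map_adj _ _ _ _).2 ⟨_, _, h, rfl, rfl⟩)

theorem Connected.attachLeaf_induce {n : ℕ} {T : SimpleGraph (Fin n)} {C : Set (Fin n)}
    (hC : (T.induce C).Connected) {t : Fin n} (ht : t ∈ C) :
    ((T.attachLeaf t).induce (Fin.castSucc '' C ∪ {Fin.last n})).Connected := by
  have h := induce_union_connected (hC.induce_image (T.attachLeafHom t)).preconnected
    (induce_pair_connected_of_adj (T.attachLeaf_adj_last t)).preconnected
    ⟨t.castSucc, ⟨t, ht, rfl⟩, by simp⟩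
  have e : Fin.castSucc '' C ∪ {Fin.last n} =
      (T.attachLeafHom t) '' C ∪ {t.castSucc, Fin.last n} := by
    ext x
    constructor
    · rintro (h | h)
      · exact Or.inl h
      · exact Or.inr (Or.inr h)
    · rintro (h | rfl | h)
      · exact Or.inl h
      · exact Or.inl ⟨t, ht, rfl⟩
      · exact Or.inr h
  rw [e]
  exact h

theorem IsTree.attachLeaf {n : ℕ} {T : SimpleGraph (Fin n)} (hT : T.IsTree) (t : Fin n) :
    (T.attachLeaf t).IsTree := by
  have hconn : (T.attachLeaf t).Connected := by
    rw [← (induceUnivIso (T.attachLeaf t)).connected_iff]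
    have h := Connected.attachLeaf_induce ((induceUnivIso T).connected_iff.2 hT.connected)
      (Set.mem_univ t)
    convert h using 2
    all_goals
      ext x
      refine Fin.lastCases ?_ (fun i => ?_) x <;> simp
  rw [isTree_iff_connected_and_card]
  refine ⟨hconn, le_antisymm ?_ hconn.card_vert_le_card_edgeSet_add_one⟩
  have h := (isTree_iff_connected_and_card.1 hT).2
  have h1 : (T.attachLeaf t).edgeSet.ncard ≤ T.edgeSet.ncard + 1 := by
    rw [SimpleGraph.attachLeaf, edgeSet_sup, edgeSet_map]
    refine (Set.ncard_union_le _ _).trans (Nat.add_le_add (Set.ncard_image_le (Set.toFinite _)) ?_)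
    rw [edgeSet_edge_of_ne (Fin.castSucc_lt_last t).ne, Set.ncard_singleton]
  rw [Nat.card_coe_set_eq, Nat.card_fin] at h ⊢
  omega

theorem IsChordalGraph.exists_treeRepresentation_on [Finite V] (hG : G.IsChordalGraph) (k : ℕ) :
    ∀ X : Set V, X.ncard = k → ∃ (n : ℕ) (T : SimpleGraph (Fin n)) (S : V → Set (Fin n)),
      T.IsTree ∧ (∀ v ∈ X, (T.induce (S v)).Connected) ∧
      ∀ u ∈ X, ∀ v ∈ X, u ≠ v → (G.Adj u v ↔ (S u ∩ S v).Nonempty) := by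
  classical
  induction k with
  | zero =>
    intro X hX
    rw [Set.ncard_eq_zero (Set.toFinite _)] at hX
    subst hX
    exact ⟨1, ⊥, fun _ => ∅, IsTree.of_subsingleton, fun v hv => hv.elim, fun v hv => hv.elim⟩
  | succ k ih =>
    intro X hX
    have hne : X.Nonempty := by
      rw [← Set.ncard_pos (Set.toFinite _)]
      omega
    obtain ⟨x, hx, hclique⟩ := hG.exists_simplicial hne
    have hcard := Set.ncard_sdiff_singleton_add_one hx (Set.toFinite _)
    obtain ⟨n, T, S, hT, hS, hadj⟩ := ih (X \ {x}) (by omega)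
    have hmemX : ∀ y ∈ X, y ≠ x → y ∈ X \ {x} := fun y hy hyx => ⟨hy, hyx⟩
    obtain ⟨t, ht⟩ := hT.exists_mem_of_pairwise_inter (ι := {y | y ∈ X ∧ G.Adj x y})
      (C := fun y => S y.1) (fun y => hS y.1 (hmemX _ y.2.1 y.2.2.ne.symm)) (by
        rintro ⟨y, hy⟩ ⟨z, hz⟩
        by_cases hyz : y = z
        · subst hyz
          obtain ⟨⟨a, ha⟩⟩ := (hS y (hmemX _ hy.1 hy.2.ne.symm)).nonempty
          exact ⟨a, ha, ha⟩
        · exact (hadj y (hmemX _ hy.1 hy.2.ne.symm) z (hmemX _ hz.1 hz.2.ne.symm) hyz).1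
            (hclique hy hz hyz))
    refine ⟨n + 1, T.attachLeaf t, fun y => if y = x then {Fin.last n} else
      if G.Adj x y then Fin.castSucc '' S y ∪ {Fin.last n} else Fin.castSucc '' S y,
      hT.attachLeaf t, ?_, ?_⟩
    · intro v hv
      by_cases hvx : v = x
      · beta_reduce
        rw [if_pos hvx]
        have : Nonempty ({Fin.last n} : Set (Fin (n + 1))) := ⟨⟨_, rfl⟩⟩
        exact ⟨by rintro ⟨a, rfl⟩ ⟨b, rfl⟩; exact Reachable.refl _⟩
      · beta_reduce
        rw [if_neg hvx]
        by_cases h : G.Adj x v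
        · rw [if_pos h]
          exact (hS v (hmemX v hv hvx)).attachLeaf_induce (ht ⟨v, hv, h⟩)
        · rw [if_neg h]
          exact (hS v (hmemX v hv hvx)).induce_image (T.attachLeafHom t)
    · have hlast : ∀ C : Set (Fin n), Fin.last n ∉ Fin.castSucc '' C := by
        rintro C ⟨a, -, ha⟩
        exact (Fin.castSucc_lt_last a).ne ha
      have hinter : ∀ C D : Set (Fin n), (Fin.castSucc '' C ∩ Fin.castSucc '' D).Nonempty ↔
          (C ∩ D).Nonempty := by
        intro C D
        rw [← Set.image_inter (Fin.castSucc_injective n), Set.image_nonempty]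
      have hcase : ∀ v ∈ X, v ≠ x → (G.Adj x v ↔ (({Fin.last n} : Set (Fin (n + 1))) ∩
          if G.Adj x v then Fin.castSucc '' S v ∪ {Fin.last n}
            else Fin.castSucc '' S v).Nonempty) := by
        intro v hv hvx
        split_ifs with h
        · exact iff_of_true h ⟨Fin.last n, rfl, Or.inr rfl⟩
        · refine iff_of_false h ?_
          rintro ⟨a, rfl, ha⟩
          exact hlast _ ha
      intro u hu v hv huv
      by_cases hux : u = x
      · subst hux
        simp only [if_true, huv.symm, if_false]
        exact hcase v hv huv.symm
      by_cases hvx : v = x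
      · subst hvx
        simp only [if_true, hux, if_false]
        rw [G.adj_comm, Set.inter_comm]
        exact hcase u hu huv
      simp only [hux, hvx, if_false]
      have hold := hadj u (hmemX u hu hux) v (hmemX v hv hvx) huv
      split_ifs with h1 h2 h2
      · exact iff_of_true (hclique ⟨hu, h1⟩ ⟨hv, h2⟩ huv) ⟨Fin.last n, Or.inr rfl, Or.inr rfl⟩
      · rw [hold, Set.union_inter_distrib_right, Set.singleton_inter_eq_empty.2 (hlast _),
          Set.union_empty, hinter]
      · rw [hold, Set.inter_union_distrib_left, Set.inter_singleton_eq_empty.2 (hlast _),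
          Set.union_empty, hinter]
      · rw [hold, hinter]

theorem IsChordalGraph.exists_treeRepresentation_leafage [Finite V] (hG : G.IsChordalGraph) :
    ∃ (n : ℕ) (T : SimpleGraph (Fin n)) (S : V → Set (Fin n)),
      G.IsTreeRepresentation T S ∧ T.numLeaves = G.leafage := by
  obtain ⟨n, T, S, hT, hS, hadj⟩ := hG.exists_treeRepresentation_on _ Set.univ rfl
  exact Nat.sInf_mem (s := {k : ℕ | ∃ (n : ℕ) (T : SimpleGraph (Fin n)) (S : V → Set (Fin n)),
    G.IsTreeRepresentation T S ∧ T.numLeaves = k}) ⟨T.numLeaves, n, T, S,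
      ⟨hT, fun v => hS v (Set.mem_univ v),
        fun u v => hadj u (Set.mem_univ u) v (Set.mem_univ v)⟩, rfl⟩

end SimpleGraph

theorem List.exists_infix_of_mem_of_mem {α : Type*} {c : List α} {x y : α} (hx : x ∈ c)
    (hy : y ∈ c) (hne : x ≠ y) :
    ∃ l, x :: (l ++ [y]) <:+: c ∨ y :: (l ++ [x]) <:+: c := by
  obtain ⟨s, t, rfl⟩ := List.append_of_mem hx
  rcases List.mem_append.1 hy with hy | hy
  · obtain ⟨s, l, rfl⟩ := List.append_of_mem hy
    exact ⟨l, Or.inr ⟨s, t, by simp⟩⟩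
  · obtain ⟨l, t, rfl⟩ := List.append_of_mem ((List.mem_cons.1 hy).resolve_left hne.symm)
    exact ⟨l, Or.inl ⟨s, t, by simp⟩⟩

namespace SimpleGraph

variable {V : Type*} {G : SimpleGraph V}

theorem IsLongestPath.longestPathList {u v : V} {p : G.Walk u v} (hp : G.IsLongestPath p) :
    G.LongestPathList p.support := by
  refine ⟨⟨p.isChain_adj_support, hp.1.support_nodup⟩, fun l hl hnd => ?_⟩
  by_cases hne : l = []
  · simp [hne]
  · obtain ⟨q, hq⟩ := exists_walk_support_eq hl hne rfl rfl
    have := hp.2 _ _ q (by rw [Walk.isPath_def, hq]; exact hnd)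
    rw [← hq, Walk.length_support, Walk.length_support]
    omega

theorem IsLongestCycle.exists_longestVertexCycle {v : V} {c : G.Walk v v}
    (hc : G.IsLongestCycle c) :
    ∃ d : Cycle V, G.LongestVertexCycle d ∧ ∀ x ∈ d, x ∈ c.support := by
  obtain ⟨m, hm, hcyc, hlen⟩ := hc.1.exists_isVertexCycle
  refine ⟨_, ⟨hcyc, fun d hd => ?_⟩, fun x hx => ?_⟩
  · induction d using Quotient.inductionOn with
    | _ l =>
    obtain ⟨hch, hnd, h3⟩ := hd
    change Cycle.Chain G.Adj (↑l : Cycle V) at hch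
    change (↑l : Cycle V).Nodup at hnd
    change 3 ≤ l.length at h3
    change l.length ≤ (v :: m).length
    cases l with
    | nil => simp
    | cons a l =>
      rw [Cycle.chain_coe_cons] at hch
      rw [Cycle.nodup_coe_iff] at hnd
      simp only [List.length_cons] at h3
      obtain ⟨q, hq, hqs⟩ := exists_isCycle_of_isChain hch hnd (by omega)
      have h1 := hc.2 _ q hq
      have h2 := q.length_support
      rw [hqs] at h2
      simp only [List.length_cons, List.length_append, List.length_nil] at h2 ⊢
      omega
  · rw [hm]
    rw [Cycle.mem_coe_iff] at hx
    rw [← List.cons_append]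
    exact List.mem_append_left _ hx

theorem IsTreeRepresentation.exists_longestPathList_transversal [Finite V] [Nonempty V]
    {W : Type*} [Finite W] {T : SimpleGraph W} {S : V → Set W}
    (h : G.IsTreeRepresentation T S) (hG : G.Preconnected) :
    ∃ A : Finset V, A.card ≤ 6 * (Nat.log 2 (max 1 T.numLeaves) + 1) + 2 ∧
      ∀ c, G.LongestPathList c → ∃ x ∈ A, x ∈ c := by
  classical
  obtain ⟨ρ⟩ := h.isTree.connected.nonempty
  obtain ⟨t, A₀, hA₀, ht⟩ : ∃ (t : W) (A : Finset V), A.card ≤ 2 ∧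
      ∀ c, G.LongestPathList c → (∀ x ∈ A, x ∉ c) → {x | x ∈ c ∧ t ∈ S x}.Nontrivial := by
    obtain ⟨_, r, R, hρ, -⟩ := h.exists_rootedRep ρ
    exact R.exists_node_nontrivial_pathList hρ hG
  obtain ⟨_, r, R, hbot, hleaves⟩ := h.exists_rootedRep t
  obtain ⟨A, hA, hA'⟩ := (exchangeFamily_longestPathList G).exists_transversal R
    (fun h => R.exists_hitting_or_innerExcursion h) _ t {x | t ∈ S x}
    {c | ∀ x ∈ A₀, x ∉ c.1} le_rfl (fun x hx => hx) (by
      intro c hc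
      obtain ⟨x, ⟨hx, hxt⟩, y, ⟨hy, hyt⟩, hxy⟩ := ht c.1 c.2 hc
      obtain ⟨l, hl | hl⟩ := List.exists_infix_of_mem_of_mem hx hy hxy
      · exact ⟨x, l, y, hl, hxt, hyt, fun w _ => hbot _⟩
      · exact ⟨y, l, x, hl, hyt, hxt, fun w _ => hbot _⟩)
  refine ⟨A ∪ A₀, ?_, fun c hc => ?_⟩
  · have := Nat.log_mono_right (b := 2) hleaves
    have := Finset.card_union_le A A₀
    omega
  · by_cases h0 : ∀ x ∈ A₀, x ∉ c
    · obtain ⟨x, hx, hxc⟩ := hA' ⟨c, hc⟩ h0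
      exact ⟨x, Finset.mem_union_left _ hx, hxc⟩
    · push Not at h0
      obtain ⟨x, hx, hxc⟩ := h0
      exact ⟨x, Finset.mem_union_right _ hx, hxc⟩

theorem IsTreeRepresentation.exists_longestVertexCycle_transversal [Finite V]
    {W : Type*} [Finite W] {T : SimpleGraph W} {S : V → Set W}
    (h : G.IsTreeRepresentation T S) (hG : ∀ s : V, (G.induce {v | v ≠ s}).Preconnected) :
    ∃ A : Finset V, A.card ≤ 6 * (Nat.log 2 (max 1 T.numLeaves) + 1) ∧
      ∀ c, G.LongestVertexCycle c → ∃ x ∈ A, x ∈ c := by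
  obtain ⟨ρ⟩ := h.isTree.connected.nonempty
  obtain ⟨t, ht⟩ : ∃ t : W, ∀ c, G.LongestVertexCycle c → {x | x ∈ c ∧ t ∈ S x}.Nontrivial := by
    obtain ⟨_, r, R, hρ, -⟩ := h.exists_rootedRep ρ
    exact R.exists_node_nontrivial_vertexCycle hρ hG
  obtain ⟨_, r, R, hbot, hleaves⟩ := h.exists_rootedRep t
  obtain ⟨A, hA, hA'⟩ := (exchangeFamily_longestVertexCycle G).exists_transversal R
    (fun h => ⟨∅, by simp, fun c _ => R.innerExcursion_vertexCycle h c⟩) _ t {x | t ∈ S x}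
    Set.univ le_rfl (fun x hx => hx) (by
      rintro ⟨c, hc⟩ -
      obtain ⟨x, ⟨hx, hxt⟩, y, ⟨hy, hyt⟩, hxy⟩ := ht c hc
      induction c using Quotient.inductionOn with
      | _ L =>
      obtain ⟨l, hl⟩ := List.exists_infix_of_mem_of_mem (c := L) hx hy hxy
      have hrot : ∀ l : List V, l <:+: L → ∃ m : List V, (↑L : Cycle V) = ↑(l ++ m) := by
        rintro l ⟨s, u, rfl⟩
        refine ⟨u ++ s, Cycle.coe_eq_coe.2 ?_⟩
        simpa using List.isRotated_append (l := s) (l' := l ++ u)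
      rcases hl with hl | hl
      · exact ⟨x, l, y, hrot _ hl, hxt, hyt, fun w _ => hbot _⟩
      · exact ⟨y, l, x, hrot _ hl, hyt, hxt, fun w _ => hbot _⟩)
  refine ⟨A, ?_, fun c hc => hA' ⟨c, hc⟩ (Set.mem_univ _)⟩
  have := Nat.log_mono_right (b := 2) hleaves
  omega

theorem lpt_le_card {A : Finset V} (hA : G.IsLongestPathTransversal A) : G.lpt ≤ A.card :=
  Nat.sInf_le ⟨A, hA, rfl⟩

theorem lct_le_card {A : Finset V} (hA : G.IsLongestCycleTransversal A) : G.lct ≤ A.card :=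
  Nat.sInf_le ⟨A, hA, rfl⟩

theorem IsChordalGraph.lpt_le [Finite V] (hG : G.IsChordalGraph) (hconn : G.Connected) :
    G.lpt ≤ 6 * (Nat.log 2 (max 1 G.leafage) + 1) + 2 := by
  obtain ⟨n, T, S, h, hleaf⟩ := hG.exists_treeRepresentation_leafage
  have := hconn.nonempty
  obtain ⟨A, hA, hA'⟩ := h.exists_longestPathList_transversal hconn.preconnected
  rw [hleaf] at hA
  exact (lpt_le_card fun u v p hp => hA' _ hp.longestPathList).trans hA

theorem IsChordalGraph.lct_le [Fintype V] (hG : G.IsChordalGraph) (hconn : G.IsKConnected 2) :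
    G.lct ≤ 6 * (Nat.log 2 (max 1 G.leafage) + 1) := by
  obtain ⟨n, T, S, h, hleaf⟩ := hG.exists_treeRepresentation_leafage
  obtain ⟨A, hA, hA'⟩ := h.exists_longestVertexCycle_transversal fun s => by
    have e : {v : V | v ≠ s} = {v | v ∉ ({s} : Finset V)} := by
      ext
      simp
    rw [e]
    exact (hconn.2 {s} (by simp)).preconnected
  rw [hleaf] at hA
  refine (lct_le_card fun v c hc => ?_).trans hA
  obtain ⟨d, hd, hdc⟩ := hc.exists_longestVertexCycle
  obtain ⟨x, hx, hxd⟩ := hA' d hd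
  exact ⟨x, hx, hdc x hxd⟩

end SimpleGraph

theorem Real.natLog_max_one_le_logb (m : ℕ) :
    (Nat.log 2 (max 1 m) : ℝ) ≤ Real.logb 2 (max (m : ℝ) 2) := by
  have h : Nat.log 2 (max 1 m) ≤ Nat.log 2 (max m 2) := Nat.log_mono_right (by omega)
  have h' := Real.natLog_le_logb (max m 2) 2
  push_cast at h'
  exact (Nat.cast_le.2 h).trans h'

theorem Real.one_le_logb_max_two (x : ℝ) : 1 ≤ Real.logb 2 (max x 2) := by
  rw [Real.le_logb_iff_rpow_le one_lt_two (by positivity), Real.rpow_one]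
  exact le_max_right _ _

theorem mainTheorem7 :
    ∃ C : ℝ, ∀ (V : Type*) [Fintype V] (G : SimpleGraph V), G.IsChordalGraph →
      (G.Connected →
        (G.lpt : ℝ) ≤ C * (Real.logb 2 (max (G.leafage : ℝ) 2)) ^ 2) ∧
      (G.IsKConnected 2 →
        (G.lct : ℝ) ≤ C * Real.logb 2 (max (G.leafage : ℝ) 2)) := by
  refine ⟨14, fun V _ G hG => ?_⟩
  have h1 := Real.natLog_max_one_le_logb G.leafage
  have h2 := Real.one_le_logb_max_two G.leafage
  refine ⟨fun hconn => ?_, fun hconn => ?_⟩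
  · have h3 : (G.lpt : ℝ) ≤ 6 * (Nat.log 2 (max 1 G.leafage) + 1) + 2 := by
      exact_mod_cast hG.lpt_le hconn
    nlinarith
  · have h3 : (G.lct : ℝ) ≤ 6 * (Nat.log 2 (max 1 G.leafage) + 1) := by
      exact_mod_cast hG.lct_le hconn
    linarith
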